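/- **Setting.** Let $N\ge 1$, $p>1$, $0<\alpha<1$, and consider the time-fractional Cauchy problem $$\partial_t^\alpha u-\Delta u=u^p \ \text{ in } (0,T)\times\mathbf R^N,\qquad u(0)=\mu, \tag{P}$$ where $\partial_t^\alpha$ is the Caputo derivative and $\mu$ is a nonnegative Radon measure (a nonnegative locally integrable function $f$ is identified with $f\,dx$). Put $G(t,x)=(4\pi t)^{-N/2}e^{-|x|^2/(4t)}$, $e^{t\Delta}\mu(x)=\int G(t,x-y)\,d\mu(y)$, and let $h_\alpha$ be the probability density on $(0,\infty)$ with $\int_0^\infty h_\alpha(\theta)e^{z\theta}d\theta=E_{\alpha,1}(z)=\sum_{k\ge0} z^k/\Gamma(\alpha k+1)$, i.e. $$h_\alpha(\theta)=\sum_{n\ge 0}\frac{(-\theta)^n}{n!\,\Gamma(1-\alpha-\alpha n)}=\frac{\theta^{\frac{\alpha}{1-\alpha}}}{\pi(1-\alpha)}\int_0^\pi A(\varphi)e^{-A(\varphi)\theta^{1/(1-\alpha)}}d\varphi,\qquad A(\varphi)=\frac{\sin(\alpha\varphi)^{\frac{\alpha}{1-\alpha}}\sin((1-\alpha)\varphi)}{(\sin\varphi)^{\frac1{1-\alpha}}}.$$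 Set $P_\alpha(t)=\int_0^\infty h_\alpha(\theta)e^{t^\alpha\theta\Delta}d\theta$ and $S_\alpha(t)=\int_0^\infty\theta h_\alpha(\theta)e^{t^\alpha\theta\Delta}d\theta$. A solution of (P) in $[0,T]\times\mathbf R^N$ is a nonnegative measurable $u$ with $$\infty>u(t,x)=[P_\alpha(t)\mu](x)+\alpha\int_0^t(t-s)^{\alpha-1}[S_\alpha(t-s)u(s)^p](x)\,ds\quad\text{for a.a. } t\in(0,T],\ x\in\mathbf R^N.$$ It is minimal if it is a.e. bounded above by every solution in $[0,T]\times\mathbf R^N$. The life span $T_\alpha[\mu]\in[0,\infty]$ is the supremum of all $T>0$ such that the minimal solution exists in $[0,T]\times\mathbf R^N$; a global-in-time solution is a function that is a solution in $[0,T]\times\mathbf R^N$ for every $T>0$. For quantities depending on $\alpha\in(0,1)$ and on a parameter $x$, $A\simeq B$ means that there are $c(\alpha),C(\alpha)>0$ independent of $x$ with $cB\le A\le CB$ for all $x$ and $\limsup_{\alpha\to1-0}c(\alpha),\ \limsup_{\alpha\to1-0}C(\alpha)\in(0,\infty)$. Let $\omega_N$ be the volume of the unit ball of $\mathbf R^N$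 and, for $j\in\{1,2,\dots\}$, $$r_j=(j\omega_N)^{-1/N},\qquad \psi_j=j\,\chi_{B(0,r_j)}.$$ **Theorem.** Let $p>p_F:=1+2/N$. (i) For each $\alpha\in(0,1)$ and each $j\ge1$ there is $\kappa_2(j)=\kappa_2(\alpha,j)\in(0,\infty)$ such that (P) with $\mu=\kappa\psi_j$ possesses a global-in-time solution if $0<\kappa<\kappa_2(j)$ and possesses no global-in-time solution if $\kappa>\kappa_2(j)$. Moreover, over all $j\ge1$, $$\kappa_2(j)\simeq j^{\frac{2}{N(p-1)}-1}.$$ (ii) For each $\alpha\in(0,1)$ there is $C>0$ such that for all $\kappa>0$ and all $j\ge1$ $$\min\{T_\alpha[\kappa\psi_j]^{\alpha/2},\,r_j\}\le C(\kappa j)^{-\frac{p-1}{2}}.$$ In particular $\lim_{j\to\infty}T_\alpha[\kappa\psi_j]=0$ for all $\alpha\in(0,1)$ and $\kappa>0$. Moreover there are $j_0(\alpha,\kappa)$ such that, over all $\kappa>0$ and $j\ge j_0(\alpha,\kappa)$, $$T_\alpha[\kappa\psi_j]\simeq(\kappa j)^{-\frac{p-1}{\alpha}},$$ with constants in $\simeq$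 that do not depend on $\kappa$ and $j$. -/

import Mathlib

open Set Filter Topology MeasureTheory
open scoped ENNReal

noncomputable section

namespace FracFujita

/-- Euclidean space `ℝ^N`. -/
abbrev Space (N : ℕ) : Type := EuclideanSpace ℝ (Fin N)

/-- The Fujita exponent `p_F = 1 + 2 / N`. -/
def fujitaExponent (N : ℕ) : ℝ := 1 + 2 / (N : ℝ)

/-- The heat kernel `G(t,x) = (4πt)^{-N/2} exp(-|x|²/(4t))`. -/
def heatKernel (N : ℕ) (t : ℝ) (x : Space N) : ℝ :=
  (4 * Real.pi * t) ^ (-((N : ℝ) / 2)) * Real.exp (-(‖x‖ ^ 2) / (4 * t))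

/-- `e^{tΔ} μ (x) = ∫ G(t, x - y) dμ(y)`, for a nonnegative measure `μ`. -/
def heat {N : ℕ} (t : ℝ) (μ : Measure (Space N)) (x : Space N) : ℝ≥0∞ :=
  ∫⁻ y, ENNReal.ofReal (heatKernel N t (x - y)) ∂μ

/-- Zolotarev's function
`A_α(φ) = sin(αφ)^{α/(1-α)} sin((1-α)φ) / sin(φ)^{1/(1-α)}` on `(0,π)`. -/
def zolotarev (α φ : ℝ) : ℝ :=
  Real.sin (α * φ) ^ (α / (1 - α)) * Real.sin ((1 - α) * φ) / Real.sin φ ^ (1 / (1 - α))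

/-- The density `h_α` on `(0,∞)` whose Laplace transform is the Mittag-Leffler function,
`∫₀^∞ h_α(θ) e^{zθ} dθ = E_{α,1}(z)`. It is the M-Wright (Mainardi) function
`∑ₙ (-θ)^n / (n! Γ(1 - α - α n))`, that is, the density of `X^{-α}` where `X` is the one-sided
`α`-stable variable with `E[e^{-sX}] = e^{-s^α}`. It is written here in the Zolotarev-Kanter
integral form (`X = (A_α(U)/W)^{(1-α)/α}` with `U` uniform on `(0,π)` and `W` standard
exponential, independent):
`h_α(θ) = θ^{α/(1-α)} / (π (1-α)) * ∫₀^π A_α(φ) exp(-A_α(φ) θ^{1/(1-α)}) dφ`. -/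
def mittagDensity (α θ : ℝ) : ℝ≥0∞ :=
  ENNReal.ofReal (θ ^ (α / (1 - α)) / (Real.pi * (1 - α))) *
    ∫⁻ φ in Ioo 0 Real.pi,
      ENNReal.ofReal (zolotarev α φ * Real.exp (-(zolotarev α φ * θ ^ (1 / (1 - α)))))

/-- `P_α(t) μ = ∫₀^∞ h_α(θ) e^{t^α θ Δ} μ dθ`. -/
def opP {N : ℕ} (α t : ℝ) (μ : Measure (Space N)) (x : Space N) : ℝ≥0∞ :=
  ∫⁻ θ in Ioi 0, mittagDensity α θ * heat (t ^ α * θ) μ x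

/-- `S_α(t) μ = ∫₀^∞ θ h_α(θ) e^{t^α θ Δ} μ dθ`. -/
def opS {N : ℕ} (α t : ℝ) (μ : Measure (Space N)) (x : Space N) : ℝ≥0∞ :=
  ∫⁻ θ in Ioi 0, ENNReal.ofReal θ * mittagDensity α θ * heat (t ^ α * θ) μ x

/-- The right-hand side of the integral equation,
`P_α(t)μ + α ∫₀^t (t-s)^{α-1} S_α(t-s) u(s)^p ds`; the function `u(s)^p` is identified with
the measure `u(s)^p dx`. -/
def duhamel {N : ℕ} (α p : ℝ) (μ : Measure (Space N)) (u : ℝ → Space N → ℝ≥0∞)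
    (t : ℝ) (x : Space N) : ℝ≥0∞ :=
  opP α t μ x + ENNReal.ofReal α *
    ∫⁻ s in Ioo 0 t, ENNReal.ofReal ((t - s) ^ (α - 1)) *
      opS α (t - s) (volume.withDensity fun y => u s y ^ p) x

/-- Lebesgue measure on `(0,T] × ℝ^N`. -/
def slab (N : ℕ) (T : ℝ) : Measure (ℝ × Space N) :=
  ((volume : Measure ℝ).restrict (Ioc 0 T)).prod volume

/-- `u` is a nonnegative solution of `∂_t^α u - Δu = u^p`, `u(0) = μ`, in `[0,T] × ℝ^N`:
it is measurable and `∞ > u = (right-hand side)` almost everywhere in `(0,T] × ℝ^N`.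
The values of `u` outside `(0,T]` play no role. -/
def IsSolution {N : ℕ} (α p : ℝ) (μ : Measure (Space N)) (T : ℝ)
    (u : ℝ → Space N → ℝ≥0∞) : Prop :=
  Measurable (Function.uncurry u) ∧
    ∀ᵐ z ∂(slab N T), u z.1 z.2 < ∞ ∧ u z.1 z.2 = duhamel α p μ u z.1 z.2

/-- The minimal solution in `[0,T] × ℝ^N`: it lies below every other solution a.e. -/
def IsMinimalSolution {N : ℕ} (α p : ℝ) (μ : Measure (Space N)) (T : ℝ)
    (u : ℝ → Space N → ℝ≥0∞) : Prop :=
  IsSolution α p μ T u ∧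
    ∀ v : ℝ → Space N → ℝ≥0∞, IsSolution α p μ T v →
      ∀ᵐ z ∂(slab N T), u z.1 z.2 ≤ v z.1 z.2

/-- The life span `T_α[μ] ∈ [0,∞]`: the supremum of all `T > 0` for which the minimal solution
exists in `[0,T] × ℝ^N`. -/
def lifespan {N : ℕ} (α p : ℝ) (μ : Measure (Space N)) : ℝ≥0∞ :=
  sSup {τ : ℝ≥0∞ | ∃ T : ℝ, 0 < T ∧ τ = ENNReal.ofReal T ∧
    ∃ u : ℝ → Space N → ℝ≥0∞, IsMinimalSolution α p μ T u}

/-- Existence of a global-in-time solution: one function solving the problem in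
`[0,T] × ℝ^N` for every `T > 0`. -/
def HasGlobalSolution {N : ℕ} (α p : ℝ) (μ : Measure (Space N)) : Prop :=
  ∃ u : ℝ → Space N → ℝ≥0∞, ∀ T : ℝ, 0 < T → IsSolution α p μ T u

/-- `ω_N`, the volume of the unit ball of `ℝ^N`. -/
def unitBallVolume (N : ℕ) : ℝ := (volume (Metric.ball (0 : Space N) 1)).toReal

/-- `r_j = (j ω_N)^{-1/N}`. -/
def radius (N j : ℕ) : ℝ := ((j : ℝ) * unitBallVolume N) ^ (-(1 / (N : ℝ)))

/-- `ψ_j = j χ_{B(0,r_j)}`. -/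
def psi (N j : ℕ) (x : Space N) : ℝ :=
  (Metric.ball (0 : Space N) (radius N j)).indicator (fun _ => (j : ℝ)) x

/-- The initial datum `κ ψ_j`, as the measure `κ ψ_j dx`. -/
def datum (N : ℕ) (κ : ℝ) (j : ℕ) : Measure (Space N) :=
  volume.withDensity fun x => ENNReal.ofReal (κ * psi N j x)

/-- The relation `A ≃ B`, for quantities depending on `α ∈ (0,1)` and a parameter `x`, with `x`
ranging over `D α`: there are `0 < c(α), C(α)`, independent of `x`, such that
`c B ≤ A ≤ C B`, and the upper limits of `c` and `C` as `α → 1-0` lie in `(0,∞)`. -/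
def SimeqOn {ι : Type*} (D : ℝ → Set ι) (A B : ℝ → ι → ℝ≥0∞) : Prop :=
  ∃ c C : ℝ → ℝ,
    (∀ α ∈ Ioo (0 : ℝ) 1, 0 < c α ∧ 0 < C α ∧ ∀ x ∈ D α,
      ENNReal.ofReal (c α) * B α x ≤ A α x ∧ A α x ≤ ENNReal.ofReal (C α) * B α x) ∧
    limsup (fun α => ENNReal.ofReal (c α)) (𝓝[<] (1 : ℝ)) ∈ Ioo (0 : ℝ≥0∞) ∞ ∧
    limsup (fun α => ENNReal.ofReal (C α)) (𝓝[<] (1 : ℝ)) ∈ Ioo (0 : ℝ≥0∞) ∞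

end FracFujita

end

/-! Everything rests on the smallest fixed point of the integral equation. The Picard iterates from
`0` increase, and by monotone convergence their supremum `picardLimit` satisfies the equation
everywhere with values in `[0,∞]` and lies a.e. below every solution. Hence a solution on `[0,T]`
exists iff `picardLimit` is a.e. finite there, and it is then the minimal one
(`isMinimalSolution_picardLimit`, `hasGlobalSolution_iff`). Solvability is also monotone in the
datum, so the global threshold is the supremum of the admissible `κ`. What remains is to estimate
`picardLimit` from both sides, with constants controlled as `α → 1`.

The uniformity in `α` comes from Kanter's representation: under `h_α dθ` the variable `θ` is `(w /
A(φ))^(1-α)`, with `φ` uniform on `(0,π)` and `w` standard exponential. Since `1/2 ≤ A(φ)^(1-α) ≤ 1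
/ sin φ`, the moments of `h_α` that are needed, and a lower bound for its mass on `[1/2,4]`, do not
depend on `α`.

Small data (`exists_hasGlobalSolution_of_small`): with `r = N(p-1)/2`, the scale-invariant exponent,
the bound `‖u(t)‖_q ≤ M t^(-αδ)` is preserved by the integral equation when the `L^r` norm of the
datum is small. Since `‖κ ψ_j‖_r = κ j^(1 - 2/(N(p-1)))`, this bounds the threshold from below.

Large data (`min_mul_rpow_le_blowupConst`): if the datum is at least `A` on `B(0,r)` and `T^α ≤ r²`,
diffusion leaves a fixed fraction of `A` in the ball up to time `T`. Feeding this bound back through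
the nonlinearity on shrinking time intervals makes it grow geometrically once `T^α A^(p-1)` exceeds
a constant, so `picardLimit` is infinite on a set of positive measure. Solvability therefore forces
`min(T^α, r²) A^(p-1) ≤ C`. With `A = κ j` and `r = r_j` this gives the upper bound of the threshold
and all upper bounds of the life span; for large `j` the minimum must be `T^α`, because `p - 1 >
2/N`. The matching lower bound of the life span only uses that the datum is bounded by `κ j`. -/

namespace FracFujita

variable {N : ℕ}

/-! ### Joint measurability of the operators -/

lemma measurable_heatKernel :
    Measurable fun z : ℝ × Space N => heatKernel N z.1 z.2 := by
  unfold heatKernel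
  fun_prop

lemma heat_withDensity (t : ℝ) {f : Space N → ℝ≥0∞} (hf : Measurable f) (x : Space N) :
    heat t (volume.withDensity f) x =
      ∫⁻ y, ENNReal.ofReal (heatKernel N t (x - y)) * f y := by
  have hG : Measurable fun y : Space N => ENNReal.ofReal (heatKernel N t (x - y)) :=
    (measurable_heatKernel.comp
      (measurable_const.prodMk (measurable_const.sub measurable_id))).ennreal_ofReal
  unfold heat
  rw [lintegral_withDensity_eq_lintegral_mul _ hf hG]
  simp [mul_comm]

lemma measurable_heat (μ : Measure (Space N)) [SFinite μ] :
    Measurable fun z : ℝ × Space N => heat z.1 μ z.2 := by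
  unfold heat
  refine Measurable.lintegral_prod_right' (f := fun w : (ℝ × Space N) × Space N =>
    ENNReal.ofReal (heatKernel N w.1.1 (w.1.2 - w.2))) ?_
  exact (measurable_heatKernel.comp (f := fun w : (ℝ × Space N) × Space N =>
    (w.1.1, w.1.2 - w.2)) (by fun_prop)).ennreal_ofReal

lemma measurable_heat_withDensity {f : ℝ → Space N → ℝ≥0∞}
    (hf : Measurable (Function.uncurry f)) :
    Measurable fun z : ℝ × ℝ × Space N => heat z.1 (volume.withDensity (f z.2.1)) z.2.2 := by
  have h : (fun z : ℝ × ℝ × Space N => heat z.1 (volume.withDensity (f z.2.1)) z.2.2) =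
      fun z => ∫⁻ y, ENNReal.ofReal (heatKernel N z.1 (z.2.2 - y)) * f z.2.1 y := by
    funext z
    exact heat_withDensity _ (hf.comp measurable_prodMk_left) _
  rw [h]
  refine Measurable.lintegral_prod_right' (f := fun w : (ℝ × ℝ × Space N) × Space N =>
    ENNReal.ofReal (heatKernel N w.1.1 (w.1.2.2 - w.2)) * f w.1.2.1 w.2) ?_
  refine Measurable.mul ?_ ?_
  · exact (measurable_heatKernel.comp (f := fun w : (ℝ × ℝ × Space N) × Space N =>
      (w.1.1, w.1.2.2 - w.2)) (by fun_prop)).ennreal_ofReal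
  · exact hf.comp (g := Function.uncurry f)
      (f := fun w : (ℝ × ℝ × Space N) × Space N => (w.1.2.1, w.2)) (by fun_prop)

lemma measurable_zolotarev (α : ℝ) : Measurable (zolotarev α) := by
  unfold zolotarev
  fun_prop

lemma measurable_mittagDensity (α : ℝ) : Measurable (mittagDensity α) := by
  unfold mittagDensity
  refine Measurable.mul (by fun_prop) ?_
  refine Measurable.lintegral_prod_right' (f := fun w : ℝ × ℝ =>
    ENNReal.ofReal (zolotarev α w.2 *
      Real.exp (-(zolotarev α w.2 * w.1 ^ (1 / (1 - α)))))) ?_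
  have h := measurable_zolotarev α
  fun_prop

lemma measurable_opP (α : ℝ) (μ : Measure (Space N)) [SFinite μ] :
    Measurable fun z : ℝ × Space N => opP α z.1 μ z.2 := by
  unfold opP
  refine Measurable.lintegral_prod_right' (f := fun w : (ℝ × Space N) × ℝ =>
    mittagDensity α w.2 * heat (w.1.1 ^ α * w.2) μ w.1.2) ?_
  refine ((measurable_mittagDensity α).comp measurable_snd).mul ?_
  exact (measurable_heat μ).comp (f := fun w : (ℝ × Space N) × ℝ =>
    (w.1.1 ^ α * w.2, w.1.2)) (by fun_prop)

lemma measurable_opS_withDensity (α : ℝ) {f : ℝ → Space N → ℝ≥0∞}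
    (hf : Measurable (Function.uncurry f)) :
    Measurable fun z : ℝ × ℝ × Space N =>
      opS α z.1 (volume.withDensity (f z.2.1)) z.2.2 := by
  unfold opS
  refine Measurable.lintegral_prod_right' (f := fun w : (ℝ × ℝ × Space N) × ℝ =>
    ENNReal.ofReal w.2 * mittagDensity α w.2 *
      heat (w.1.1 ^ α * w.2) (volume.withDensity (f w.1.2.1)) w.1.2.2) ?_
  refine ((by fun_prop : Measurable fun w : (ℝ × ℝ × Space N) × ℝ =>
    ENNReal.ofReal w.2).mul ((measurable_mittagDensity α).comp measurable_snd)).mul ?_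
  exact (measurable_heat_withDensity hf).comp (f := fun w : (ℝ × ℝ × Space N) × ℝ =>
    (w.1.1 ^ α * w.2, w.1.2.1, w.1.2.2)) (by fun_prop)

lemma measurable_duhamel (α p : ℝ) (μ : Measure (Space N)) [SFinite μ]
    {u : ℝ → Space N → ℝ≥0∞} (hu : Measurable (Function.uncurry u)) :
    Measurable (Function.uncurry (duhamel α p μ u)) := by
  have hup : Measurable (Function.uncurry fun (s : ℝ) (y : Space N) => u s y ^ p) :=
    hu.pow_const p
  -- The domain of integration depends on `t`; moving it into an indicator makes the integrand
  -- jointly measurable on a fixed product.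
  have h : Function.uncurry (duhamel α p μ u) = fun z : ℝ × Space N =>
      opP α z.1 μ z.2 + ENNReal.ofReal α * ∫⁻ s, {w : (ℝ × Space N) × ℝ |
        0 < w.2 ∧ w.2 < w.1.1}.indicator (fun w => ENNReal.ofReal ((w.1.1 - w.2) ^ (α - 1)) *
          opS α (w.1.1 - w.2) (volume.withDensity fun y => u w.2 y ^ p) w.1.2) (z, s) := by
    funext z
    simp only [Function.uncurry, duhamel]
    rw [← lintegral_indicator measurableSet_Ioo]
    rfl
  rw [h]
  refine (measurable_opP α μ).add (Measurable.const_mul ?_ _)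
  refine Measurable.lintegral_prod_right' ?_
  refine Measurable.indicator ?_ ?_
  · refine Measurable.mul (by fun_prop) ?_
    exact (measurable_opS_withDensity α hup).comp (f := fun w : (ℝ × Space N) × ℝ =>
      (w.1.1 - w.2, w.2, w.1.2)) (by fun_prop)
  · exact (measurableSet_lt measurable_const measurable_snd).inter
      (measurableSet_lt measurable_snd measurable_fst.fst)

/-! ### Monotonicity, Picard iteration and the minimal solution -/

lemma heat_mono (t : ℝ) {μ ν : Measure (Space N)} (h : μ ≤ ν) (x : Space N) :
    heat t μ x ≤ heat t ν x :=
  lintegral_mono' h le_rfl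

lemma opP_mono (α t : ℝ) {μ ν : Measure (Space N)} (h : μ ≤ ν) (x : Space N) :
    opP α t μ x ≤ opP α t ν x :=
  lintegral_mono fun _ => mul_le_mul_right (heat_mono _ h x) _

lemma opS_mono (α t : ℝ) {μ ν : Measure (Space N)} (h : μ ≤ ν) (x : Space N) :
    opS α t μ x ≤ opS α t ν x :=
  lintegral_mono fun _ => mul_le_mul_right (heat_mono _ h x) _

/-- Comparison almost everywhere on almost every earlier time slice is enough, since `u` enters only
under integrals. This allows comparison with solutions that satisfy the equation only a.e. -/
lemma duhamel_mono {α p : ℝ} (hp : 0 ≤ p) {μ ν : Measure (Space N)} (hμ : μ ≤ ν)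
    {u v : ℝ → Space N → ℝ≥0∞} {t : ℝ}
    (h : ∀ᵐ s ∂(volume.restrict (Ioo 0 t)), ∀ᵐ y, u s y ≤ v s y) (x : Space N) :
    duhamel α p μ u t x ≤ duhamel α p ν v t x := by
  refine add_le_add (opP_mono α t hμ x) (mul_le_mul_right (lintegral_mono_ae ?_) _)
  filter_upwards [h] with s hs
  refine mul_le_mul_right (opS_mono _ _ (withDensity_mono ?_) x) _
  filter_upwards [hs] with y hy
  exact ENNReal.rpow_le_rpow hy hp

/-- The Picard iterates of the integral equation, started from `0`. -/
noncomputable def picard (α p : ℝ) (μ : Measure (Space N)) : ℕ → ℝ → Space N → ℝ≥0∞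
  | 0 => fun _ _ => 0
  | n + 1 => duhamel α p μ (picard α p μ n)

/-- The supremum of the Picard iterates. -/
noncomputable def picardLimit (α p : ℝ) (μ : Measure (Space N)) (t : ℝ) (x : Space N) : ℝ≥0∞ :=
  ⨆ n, picard α p μ n t x

lemma measurable_picard (α p : ℝ) (μ : Measure (Space N)) [SFinite μ] (n : ℕ) :
    Measurable (Function.uncurry (picard α p μ n)) := by
  induction n with
  | zero => exact measurable_const
  | succ n ih => exact measurable_duhamel α p μ ih

lemma measurable_picardLimit (α p : ℝ) (μ : Measure (Space N)) [SFinite μ] :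
    Measurable (Function.uncurry (picardLimit α p μ)) :=
  Measurable.iSup fun n => measurable_picard α p μ n

lemma picard_le_succ {p : ℝ} (hp : 0 ≤ p) (α : ℝ) (μ : Measure (Space N)) (n : ℕ) :
    ∀ t x, picard α p μ n t x ≤ picard α p μ (n + 1) t x := by
  induction n with
  | zero => intro t x; exact zero_le
  | succ n ih =>
    intro t x
    exact duhamel_mono hp le_rfl (ae_of_all _ fun s => ae_of_all _ fun y => ih s y) x

lemma monotone_picard {p : ℝ} (hp : 0 ≤ p) (α : ℝ) (μ : Measure (Space N)) (t : ℝ)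
    (x : Space N) : Monotone fun n => picard α p μ n t x :=
  monotone_nat_of_le_succ fun n => picard_le_succ hp α μ n t x

lemma picard_mono_measure {p : ℝ} (hp : 0 ≤ p) (α : ℝ) {μ ν : Measure (Space N)} (h : μ ≤ ν)
    (n : ℕ) : ∀ t x, picard α p μ n t x ≤ picard α p ν n t x := by
  induction n with
  | zero => intro t x; exact le_rfl
  | succ n ih =>
    intro t x
    exact duhamel_mono hp h (ae_of_all _ fun s => ae_of_all _ fun y => ih s y) x

lemma picardLimit_mono_measure {p : ℝ} (hp : 0 ≤ p) (α : ℝ) {μ ν : Measure (Space N)}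
    (h : μ ≤ ν) (t : ℝ) (x : Space N) : picardLimit α p μ t x ≤ picardLimit α p ν t x :=
  iSup_mono fun n => picard_mono_measure hp α h n t x

lemma heat_withDensity_iSup (t : ℝ) {f : ℕ → Space N → ℝ≥0∞} (hf : ∀ n, Measurable (f n))
    (hm : Monotone f) (x : Space N) :
    heat t (volume.withDensity fun y => ⨆ n, f n y) x =
      ⨆ n, heat t (volume.withDensity (f n)) x := by
  rw [heat_withDensity t (Measurable.iSup hf)]
  simp_rw [fun n => heat_withDensity t (hf n) x, ENNReal.mul_iSup]
  refine lintegral_iSup (fun n => Measurable.mul ?_ (hf n)) ?_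
  · exact (measurable_heatKernel.comp
      (measurable_const.prodMk (measurable_const.sub measurable_id))).ennreal_ofReal
  · exact fun m n h y => mul_le_mul_right (hm h y) _

lemma opS_withDensity_iSup (α t : ℝ) {f : ℕ → Space N → ℝ≥0∞} (hf : ∀ n, Measurable (f n))
    (hm : Monotone f) (x : Space N) :
    opS α t (volume.withDensity fun y => ⨆ n, f n y) x =
      ⨆ n, opS α t (volume.withDensity (f n)) x := by
  unfold opS
  simp_rw [heat_withDensity_iSup _ hf hm, ENNReal.mul_iSup]
  refine lintegral_iSup (fun n => ?_) ?_
  · refine (ENNReal.measurable_ofReal.mul (measurable_mittagDensity α)).mul ?_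
    exact (measurable_heat _).comp (f := fun θ : ℝ => (t ^ α * θ, x)) (by fun_prop)
  · exact fun m n h θ => mul_le_mul_right (heat_mono _ (withDensity_mono
      (ae_of_all _ (hm h))) x) _

/-- Monotone convergence, applied in turn to the integrals in `y`, in `θ` and in `s`; the power
commutes with suprema because `x ↦ x ^ p` is an order isomorphism of `[0,∞]`. -/
lemma duhamel_iSup (α : ℝ) {p : ℝ} (hp : 0 < p) (μ : Measure (Space N))
    {u : ℕ → ℝ → Space N → ℝ≥0∞} (hu : ∀ n, Measurable (Function.uncurry (u n)))
    (hm : ∀ t x, Monotone fun n => u n t x) (t : ℝ) (x : Space N) :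
    duhamel α p μ (fun s y => ⨆ n, u n s y) t x = ⨆ n, duhamel α p μ (u n) t x := by
  have hpow : ∀ s y, (⨆ n, u n s y) ^ p = ⨆ n, u n s y ^ p := fun s y =>
    (ENNReal.orderIsoRpow p hp).map_iSup _
  have hmono : ∀ s, Monotone fun n y => u n s y ^ p := fun s m n h y =>
    ENNReal.rpow_le_rpow (hm s y h) hp.le
  have hmeas : ∀ n, Measurable (Function.uncurry fun s y => u n s y ^ p) := fun n =>
    (hu n).pow_const p
  unfold duhamel
  simp_rw [hpow]
  simp_rw [fun s => opS_withDensity_iSup α (t - s) (f := fun n y => u n s y ^ p)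
    (fun n => (hmeas n).comp measurable_prodMk_left) (hmono s) x, ENNReal.mul_iSup]
  rw [lintegral_iSup, ENNReal.mul_iSup, ENNReal.add_iSup]
  · intro n
    refine Measurable.mul (by fun_prop) ?_
    exact (measurable_opS_withDensity α (hmeas n)).comp (f := fun s : ℝ =>
      (t - s, s, x)) (by fun_prop)
  · exact fun m n h s => mul_le_mul_right (opS_mono _ _ (withDensity_mono
      (ae_of_all _ (hmono s h))) x) _

/-- No finiteness is needed: the identity holds at every point in `[0,∞]`. Finiteness is thus the
only obstruction to solvability, and lower bounds can be iterated on `picardLimit` itself. -/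
lemma duhamel_picardLimit (α : ℝ) {p : ℝ} (hp : 0 < p) (μ : Measure (Space N)) [SFinite μ]
    (t : ℝ) (x : Space N) :
    duhamel α p μ (picardLimit α p μ) t x = picardLimit α p μ t x := by
  have h := duhamel_iSup α hp μ (measurable_picard α p μ)
    (fun t x => monotone_picard hp.le α μ t x) t x
  refine h.trans ?_
  exact (monotone_picard hp.le α μ t x).iSup_nat_add 1

lemma ae_mem_Ioc_slab (T : ℝ) : ∀ᵐ z ∂(slab N T), z.1 ∈ Ioc 0 T :=
  (Measure.quasiMeasurePreserving_fst (μ := (volume : Measure ℝ).restrict (Ioc 0 T))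
    (ν := (volume : Measure (Space N)))).ae (ae_restrict_mem measurableSet_Ioc)

lemma picard_le_solution {α p : ℝ} (hp : 0 ≤ p) {μ : Measure (Space N)} {T : ℝ}
    {v : ℝ → Space N → ℝ≥0∞} (hv : IsSolution α p μ T v) (n : ℕ) :
    ∀ᵐ z ∂(slab N T), picard α p μ n z.1 z.2 ≤ v z.1 z.2 := by
  induction n with
  | zero => exact ae_of_all _ fun z => zero_le
  | succ n ih =>
    have h1 := Measure.ae_ae_of_ae_prod ih
    filter_upwards [hv.2, ae_mem_Ioc_slab T] with z hz hzT
    rw [hz.2]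
    refine duhamel_mono hp le_rfl ?_ z.2
    have hsub : Ioo 0 z.1 ⊆ Ioc 0 T := fun s hs => ⟨hs.1, hs.2.le.trans hzT.2⟩
    exact ae_restrict_of_ae_restrict_of_subset hsub h1

lemma picardLimit_le_solution {α p : ℝ} (hp : 0 ≤ p) {μ : Measure (Space N)} {T : ℝ}
    {v : ℝ → Space N → ℝ≥0∞} (hv : IsSolution α p μ T v) :
    ∀ᵐ z ∂(slab N T), picardLimit α p μ z.1 z.2 ≤ v z.1 z.2 := by
  filter_upwards [ae_all_iff.2 (picard_le_solution hp hv)] with z hz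
  exact iSup_le hz

lemma isSolution_picardLimit {α p : ℝ} (hp : 0 < p) {μ : Measure (Space N)} [SFinite μ] {T : ℝ}
    (h : ∀ᵐ z ∂(slab N T), picardLimit α p μ z.1 z.2 < ∞) :
    IsSolution α p μ T (picardLimit α p μ) := by
  refine ⟨measurable_picardLimit α p μ, ?_⟩
  filter_upwards [h] with z hz
  exact ⟨hz, (duhamel_picardLimit α hp μ z.1 z.2).symm⟩

lemma isMinimalSolution_picardLimit {α p : ℝ} (hp : 0 < p) {μ : Measure (Space N)} [SFinite μ]
    {T : ℝ} (h : ∀ᵐ z ∂(slab N T), picardLimit α p μ z.1 z.2 < ∞) :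
    IsMinimalSolution α p μ T (picardLimit α p μ) :=
  ⟨isSolution_picardLimit hp h, fun _ hv => picardLimit_le_solution hp.le hv⟩

lemma picardLimit_lt_top_of_isSolution {α p : ℝ} (hp : 0 ≤ p) {μ : Measure (Space N)} {T : ℝ}
    {v : ℝ → Space N → ℝ≥0∞} (hv : IsSolution α p μ T v) :
    ∀ᵐ z ∂(slab N T), picardLimit α p μ z.1 z.2 < ∞ := by
  filter_upwards [picardLimit_le_solution hp hv, hv.2] with z h1 h2
  exact h1.trans_lt h2.1

/-- `picardLimit` does not depend on `T`, so solvability on each `[0,T]` separately yields a single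
global solution. -/
lemma hasGlobalSolution_iff {α p : ℝ} (hp : 0 < p) {μ : Measure (Space N)} [SFinite μ] :
    HasGlobalSolution α p μ ↔
      ∀ T : ℝ, 0 < T → ∀ᵐ z ∂(slab N T), picardLimit α p μ z.1 z.2 < ∞ :=
  ⟨fun ⟨_, hu⟩ T hT => picardLimit_lt_top_of_isSolution hp.le (hu T hT),
    fun h => ⟨_, fun T hT => isSolution_picardLimit hp (h T hT)⟩⟩

lemma HasGlobalSolution.mono {α p : ℝ} (hp : 0 < p) {μ ν : Measure (Space N)} [SFinite μ]
    [SFinite ν] (h : μ ≤ ν) (hν : HasGlobalSolution α p ν) : HasGlobalSolution α p μ := by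
  rw [hasGlobalSolution_iff hp] at hν ⊢
  intro T hT
  filter_upwards [hν T hT] with z hz
  exact (picardLimit_mono_measure hp.le α h _ _).trans_lt hz

lemma ofReal_le_lifespan {α p : ℝ} (hp : 0 < p) {μ : Measure (Space N)} [SFinite μ] {T : ℝ}
    (hT : 0 < T) (h : ∀ᵐ z ∂(slab N T), picardLimit α p μ z.1 z.2 < ∞) :
    ENNReal.ofReal T ≤ lifespan α p μ :=
  le_sSup ⟨T, hT, rfl, _, isMinimalSolution_picardLimit hp h⟩

lemma exists_of_lt_lifespan {α p : ℝ} (hp : 0 ≤ p) {μ : Measure (Space N)} {τ : ℝ≥0∞}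
    (h : τ < lifespan α p μ) : ∃ T : ℝ, 0 < T ∧ τ < ENNReal.ofReal T ∧
      ∀ᵐ z ∂(slab N T), picardLimit α p μ z.1 z.2 < ∞ := by
  obtain ⟨_, ⟨T, hT, rfl, u, hu⟩, hτ⟩ := lt_sSup_iff.1 h
  exact ⟨T, hT, hτ, picardLimit_lt_top_of_isSolution hp hu.1⟩

lemma slab_mono {S T : ℝ} (h : S ≤ T) : slab N S ≤ slab N T :=
  Measure.prod_mono (Measure.restrict_mono (Ioc_subset_Ioc_right h) le_rfl) le_rfl

/-! ### Bounds for the density `h_α`, uniform in `α` -/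

lemma zolotarev_pos {α φ : ℝ} (hα : α ∈ Ioo (0 : ℝ) 1) (hφ : φ ∈ Ioo 0 Real.pi) :
    0 < zolotarev α φ := by
  obtain ⟨h0, h1⟩ := hα
  obtain ⟨p0, p1⟩ := hφ
  have e1 : 0 < Real.sin (α * φ) :=
    Real.sin_pos_of_pos_of_lt_pi (by positivity) (by nlinarith)
  have e2 : 0 < Real.sin ((1 - α) * φ) :=
    Real.sin_pos_of_pos_of_lt_pi (mul_pos (by linarith) p0) (by nlinarith)
  have e3 : 0 < Real.sin φ := Real.sin_pos_of_pos_of_lt_pi p0 p1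
  unfold zolotarev
  positivity

/-- The power `1 - α` removes the exponents that blow up as `α → 1`; only `A(φ)^(1-α)` occurs in the
substitution for `θ`. -/
lemma zolotarev_rpow {α φ : ℝ} (hα : α ∈ Ioo (0 : ℝ) 1) (hφ : φ ∈ Ioo 0 Real.pi) :
    zolotarev α φ ^ (1 - α) =
      Real.sin (α * φ) ^ α * Real.sin ((1 - α) * φ) ^ (1 - α) / Real.sin φ := by
  obtain ⟨h0, h1⟩ := hα
  obtain ⟨p0, p1⟩ := hφ
  have e1 : 0 < Real.sin (α * φ) :=
    Real.sin_pos_of_pos_of_lt_pi (by positivity) (by nlinarith)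
  have e2 : 0 < Real.sin ((1 - α) * φ) :=
    Real.sin_pos_of_pos_of_lt_pi (mul_pos (by linarith) p0) (by nlinarith)
  have e3 : 0 < Real.sin φ := Real.sin_pos_of_pos_of_lt_pi p0 p1
  have h2 : 1 - α ≠ 0 := by linarith
  unfold zolotarev
  rw [Real.div_rpow (by positivity) (by positivity), Real.mul_rpow (by positivity) e2.le,
    ← Real.rpow_mul e1.le, ← Real.rpow_mul e3.le, div_mul_cancel₀ _ h2, div_mul_cancel₀ _ h2,
    Real.rpow_one]

lemma mul_sin_le_sin_mul {α φ : ℝ} (hα : α ∈ Ioo (0 : ℝ) 1) (hφ : φ ∈ Ioo 0 Real.pi) :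
    α * Real.sin φ ≤ Real.sin (α * φ) := by
  have h := strictConcaveOn_sin_Icc.concaveOn.2 ⟨hφ.1.le, hφ.2.le⟩ ⟨le_rfl, Real.pi_pos.le⟩
    hα.1.le (sub_nonneg.2 hα.2.le) (by ring)
  simpa using h

/-- Concavity of `sin` on `[0,π]` gives the lower bound `α^α (1-α)^(1-α)`, and weighted AM-GM
applied to `1/α` and `1/(1-α)` bounds its inverse by `2`. -/
lemma half_le_zolotarev_rpow {α φ : ℝ} (hα : α ∈ Ioo (0 : ℝ) 1) (hφ : φ ∈ Ioo 0 Real.pi) :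
    1 / 2 ≤ zolotarev α φ ^ (1 - α) := by
  have e3 : 0 < Real.sin φ := Real.sin_pos_of_pos_of_lt_pi hφ.1 hφ.2
  have hβ : 1 - α ∈ Ioo (0 : ℝ) 1 := ⟨by linarith [hα.2], by linarith [hα.1]⟩
  have e1 := mul_sin_le_sin_mul hα hφ
  have e2 := mul_sin_le_sin_mul hβ hφ
  have h1 : (α * Real.sin φ) ^ α ≤ Real.sin (α * φ) ^ α :=
    Real.rpow_le_rpow (mul_nonneg hα.1.le e3.le) e1 hα.1.le
  have h2 : ((1 - α) * Real.sin φ) ^ (1 - α) ≤ Real.sin ((1 - α) * φ) ^ (1 - α) :=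
    Real.rpow_le_rpow (mul_nonneg hβ.1.le e3.le) e2 hβ.1.le
  have h3 : (α * Real.sin φ) ^ α * ((1 - α) * Real.sin φ) ^ (1 - α) =
      (α ^ α * (1 - α) ^ (1 - α)) * Real.sin φ := by
    rw [Real.mul_rpow hα.1.le e3.le, Real.mul_rpow hβ.1.le e3.le]
    calc _ = (α ^ α * (1 - α) ^ (1 - α)) * (Real.sin φ ^ α * Real.sin φ ^ (1 - α)) := by ring
      _ = _ := by rw [← Real.rpow_add e3]; simp
  have h4 : 1 / 2 ≤ α ^ α * (1 - α) ^ (1 - α) := by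
    have := Real.geom_mean_le_arith_mean2_weighted hα.1.le hβ.1.le
      (inv_nonneg.2 hα.1.le) (inv_nonneg.2 hβ.1.le) (by ring)
    rw [mul_inv_cancel₀ hα.1.ne', mul_inv_cancel₀ hβ.1.ne', Real.inv_rpow hα.1.le,
      Real.inv_rpow hβ.1.le, ← mul_inv] at this
    have hpos : 0 < α ^ α * (1 - α) ^ (1 - α) :=
      mul_pos (Real.rpow_pos_of_pos hα.1 _) (Real.rpow_pos_of_pos hβ.1 _)
    rw [inv_le_comm₀ hpos (by norm_num)] at this
    norm_num at this ⊢
    linarith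
  rw [zolotarev_rpow hα hφ, le_div_iff₀ e3]
  calc 1 / 2 * Real.sin φ ≤ (α ^ α * (1 - α) ^ (1 - α)) * Real.sin φ :=
        mul_le_mul_of_nonneg_right h4 e3.le
    _ ≤ _ := by
        rw [← h3]
        exact mul_le_mul h1 h2 (Real.rpow_nonneg (mul_nonneg hβ.1.le e3.le) _)
          ((Real.rpow_nonneg (mul_nonneg hα.1.le e3.le) _).trans h1)

lemma zolotarev_rpow_le {α φ : ℝ} (hα : α ∈ Ioo (0 : ℝ) 1) (hφ : φ ∈ Ioo 0 Real.pi) :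
    zolotarev α φ ^ (1 - α) ≤ (Real.sin φ)⁻¹ := by
  obtain ⟨h0, h1⟩ := hα
  obtain ⟨p0, p1⟩ := hφ
  have e1 : 0 < Real.sin (α * φ) :=
    Real.sin_pos_of_pos_of_lt_pi (by positivity) (by nlinarith)
  have e2 : 0 < Real.sin ((1 - α) * φ) :=
    Real.sin_pos_of_pos_of_lt_pi (mul_pos (by linarith) p0) (by nlinarith)
  have e3 : 0 < Real.sin φ := Real.sin_pos_of_pos_of_lt_pi p0 p1
  rw [zolotarev_rpow ⟨h0, h1⟩ ⟨p0, p1⟩, div_eq_mul_inv]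
  refine mul_le_of_le_one_left (inv_nonneg.2 e3.le) ?_
  exact mul_le_one₀ (Real.rpow_le_one e1.le (Real.sin_le_one _) h0.le)
    (Real.rpow_nonneg e2.le _) (Real.rpow_le_one e2.le (Real.sin_le_one _) (by linarith))

lemma image_mul_rpow_Ioi {a b : ℝ} (ha : 0 < a) (hb : 0 < b) :
    (fun θ : ℝ => a * θ ^ b) '' Ioi 0 = Ioi 0 := by
  ext w
  constructor
  · rintro ⟨θ, hθ, rfl⟩
    exact mul_pos ha (Real.rpow_pos_of_pos hθ b)
  · intro hw
    have hw' : 0 < w / a := div_pos hw ha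
    refine ⟨(w / a) ^ b⁻¹, Real.rpow_pos_of_pos hw' _, ?_⟩
    simp only
    rw [← Real.rpow_mul hw'.le, inv_mul_cancel₀ hb.ne', Real.rpow_one]
    field_simp

/-- The substitution `w = a θ^{1/(1-α)}`. -/
lemma lintegral_mul_rpow_substitution {α a : ℝ} (hα : α ∈ Ioo (0 : ℝ) 1) (ha : 0 < a)
    (g : ℝ → ℝ≥0∞) :
    ∫⁻ θ in Ioi 0, ENNReal.ofReal (θ ^ (α / (1 - α)) / (Real.pi * (1 - α))) *
        ENNReal.ofReal (a * Real.exp (-(a * θ ^ (1 / (1 - α))))) * g θ =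
      ENNReal.ofReal Real.pi⁻¹ *
        ∫⁻ w in Ioi 0, ENNReal.ofReal (Real.exp (-w)) * g ((w / a) ^ (1 - α)) := by
  have hβ : 0 < 1 - α := by linarith [hα.2]
  set b := 1 / (1 - α) with hb
  have hb0 : 0 < b := by positivity
  have key := lintegral_image_eq_lintegral_abs_deriv_mul (s := Ioi (0 : ℝ))
    (f := fun θ => a * θ ^ b) (f' := fun θ => a * (b * θ ^ (b - 1))) measurableSet_Ioi
    (fun θ hθ => ((Real.hasDerivAt_rpow_const (Or.inl (ne_of_gt hθ))).const_mul a).hasDerivWithinAt)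
    (by
      intro x hx y hy h
      have h' : x ^ b = y ^ b := mul_left_cancel₀ ha.ne' h
      exact (Real.rpow_left_inj (le_of_lt hx) (le_of_lt hy) hb0.ne').1 h')
    (fun w => ENNReal.ofReal (Real.exp (-w)) * g ((w / a) ^ (1 - α)))
  rw [image_mul_rpow_Ioi ha hb0] at key
  rw [key, ← lintegral_const_mul' _ _ ENNReal.ofReal_ne_top]
  refine setLIntegral_congr_fun measurableSet_Ioi fun θ hθ => ?_
  have hθ0 : (0 : ℝ) < θ := hθ
  have h1 : (a * θ ^ b / a) ^ (1 - α) = θ := by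
    rw [mul_div_cancel_left₀ _ ha.ne', ← Real.rpow_mul hθ0.le, hb, one_div_mul_cancel hβ.ne',
      Real.rpow_one]
  -- The Jacobian `a b θ^(b-1)` thus reproduces the prefactor of `h_α` up to `1/π`.
  have h2 : b - 1 = α / (1 - α) := by rw [hb]; field_simp; ring
  have hθr : 0 < θ ^ (α / (1 - α)) := Real.rpow_pos_of_pos hθ0 _
  have hpi := Real.pi_pos
  simp only [h1, h2]
  rw [abs_of_pos (by positivity), ← mul_assoc, ← mul_assoc, ← ENNReal.ofReal_mul (by positivity),
    ← ENNReal.ofReal_mul (by positivity), ← ENNReal.ofReal_mul (by positivity)]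
  congr 2
  rw [hb]
  field_simp

/-- Integration against `h_α` in the variables of the Kanter representation. -/
lemma lintegral_mittagDensity_mul {α : ℝ} (hα : α ∈ Ioo (0 : ℝ) 1) {g : ℝ → ℝ≥0∞}
    (hg : Measurable g) :
    ∫⁻ θ in Ioi 0, mittagDensity α θ * g θ =
      ENNReal.ofReal Real.pi⁻¹ * ∫⁻ φ in Ioo 0 Real.pi, ∫⁻ w in Ioi 0,
        ENNReal.ofReal (Real.exp (-w)) * g ((w / zolotarev α φ) ^ (1 - α)) := by
  have hz := measurable_zolotarev α
  have hin : ∀ θ : ℝ, Measurable fun φ : ℝ => ENNReal.ofReal (zolotarev α φ *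
      Real.exp (-(zolotarev α φ * θ ^ (1 / (1 - α))))) := fun θ => by fun_prop
  calc ∫⁻ θ in Ioi 0, mittagDensity α θ * g θ
      = ∫⁻ θ in Ioi 0, ∫⁻ φ in Ioo 0 Real.pi,
          ENNReal.ofReal (θ ^ (α / (1 - α)) / (Real.pi * (1 - α))) *
          ENNReal.ofReal (zolotarev α φ *
            Real.exp (-(zolotarev α φ * θ ^ (1 / (1 - α))))) * g θ := by
        refine lintegral_congr fun θ => ?_
        rw [lintegral_mul_const _ ((hin θ).const_mul _), lintegral_const_mul _ (hin θ)]
        rfl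
    _ = ∫⁻ φ in Ioo 0 Real.pi, ∫⁻ θ in Ioi 0,
          ENNReal.ofReal (θ ^ (α / (1 - α)) / (Real.pi * (1 - α))) *
          ENNReal.ofReal (zolotarev α φ *
            Real.exp (-(zolotarev α φ * θ ^ (1 / (1 - α))))) * g θ := by
        refine lintegral_lintegral_swap (Measurable.aemeasurable ?_)
        have h1 : Measurable fun w : ℝ × ℝ => g w.1 := hg.comp measurable_fst
        have h2 : Measurable fun w : ℝ × ℝ => zolotarev α w.2 := hz.comp measurable_snd
        refine Measurable.mul (f := fun w : ℝ × ℝ => _) ?_ h1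
        fun_prop
    _ = ∫⁻ φ in Ioo 0 Real.pi, ENNReal.ofReal Real.pi⁻¹ * ∫⁻ w in Ioi 0,
          ENNReal.ofReal (Real.exp (-w)) * g ((w / zolotarev α φ) ^ (1 - α)) :=
        setLIntegral_congr_fun measurableSet_Ioo fun φ hφ =>
          lintegral_mul_rpow_substitution hα (zolotarev_pos hα hφ) g
    _ = _ := lintegral_const_mul' _ _ ENNReal.ofReal_ne_top

lemma lintegral_exp_mul_rpow {s : ℝ} (hs : 0 < s) :
    ∫⁻ w in Ioi 0, ENNReal.ofReal (Real.exp (-w) * w ^ (s - 1)) =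
      ENNReal.ofReal (Real.Gamma s) := by
  rw [Real.Gamma_eq_integral hs,
    ofReal_integral_eq_lintegral_ofReal (Real.GammaIntegral_convergent hs)]
  filter_upwards [ae_restrict_mem measurableSet_Ioi] with w hw
  have : (0 : ℝ) < w := hw
  positivity

lemma lintegral_exp_neg :
    ∫⁻ w in Ioi (0 : ℝ), ENNReal.ofReal (Real.exp (-w)) = 1 := by
  simpa using lintegral_exp_mul_rpow (s := 1) one_pos

lemma lintegral_mittagDensity {α : ℝ} (hα : α ∈ Ioo (0 : ℝ) 1) :
    ∫⁻ θ in Ioi 0, mittagDensity α θ = 1 := by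
  have h := lintegral_mittagDensity_mul hα (g := fun _ => 1) measurable_const
  simp only [mul_one, lintegral_exp_neg] at h
  rw [h]
  simp only [lintegral_const, MeasurableSet.univ, Measure.restrict_apply, univ_inter,
    Real.volume_Ioo, sub_zero, one_mul]
  rw [← ENNReal.ofReal_mul (inv_nonneg.2 Real.pi_pos.le), inv_mul_cancel₀ Real.pi_ne_zero,
    ENNReal.ofReal_one]

lemma div_zolotarev_rpow_le {α φ w : ℝ} (hα : α ∈ Ioo (0 : ℝ) 1) (hφ : φ ∈ Ioo 0 Real.pi)
    (hw : 0 < w) : (w / zolotarev α φ) ^ (1 - α) ≤ 2 * w ^ (1 - α) := by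
  have h1 := half_le_zolotarev_rpow hα hφ
  have h2 : 0 < w ^ (1 - α) := Real.rpow_pos_of_pos hw _
  rw [Real.div_rpow hw.le (zolotarev_pos hα hφ).le, div_le_iff₀ (by linarith)]
  nlinarith

lemma le_div_zolotarev_rpow {α φ w : ℝ} (hα : α ∈ Ioo (0 : ℝ) 1) (hφ : φ ∈ Ioo 0 Real.pi)
    (hw : 0 < w) : Real.sin φ * w ^ (1 - α) ≤ (w / zolotarev α φ) ^ (1 - α) := by
  have e3 : 0 < Real.sin φ := Real.sin_pos_of_pos_of_lt_pi hφ.1 hφ.2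
  have h1 := zolotarev_rpow_le hα hφ
  have h0 := half_le_zolotarev_rpow hα hφ
  have h2 : 0 < w ^ (1 - α) := Real.rpow_pos_of_pos hw _
  rw [Real.div_rpow hw.le (zolotarev_pos hα hφ).le, le_div_iff₀ (by linarith)]
  calc Real.sin φ * w ^ (1 - α) * zolotarev α φ ^ (1 - α)
      ≤ Real.sin φ * w ^ (1 - α) * (Real.sin φ)⁻¹ :=
        mul_le_mul_of_nonneg_left h1 (by positivity)
    _ = _ := by field_simp

lemma rpow_le_one_add_self {w s : ℝ} (hw : 0 < w) (hs0 : 0 ≤ s) (hs1 : s ≤ 1) :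
    w ^ s ≤ 1 + w := by
  rcases le_total w 1 with h | h
  · exact (Real.rpow_le_one hw.le h hs0).trans (by linarith)
  · exact (Real.rpow_le_rpow_of_exponent_le h hs1).trans (by rw [Real.rpow_one]; linarith)

/-- In Kanter's variables `θ ≤ 2 w^(1-α) ≤ 2(1 + w)`, whose exponential mean is `4`. -/
lemma lintegral_mul_mittagDensity_le {α : ℝ} (hα : α ∈ Ioo (0 : ℝ) 1) :
    ∫⁻ θ in Ioi 0, ENNReal.ofReal θ * mittagDensity α θ ≤ 4 := by
  simp_rw [mul_comm (ENNReal.ofReal _)]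
  rw [lintegral_mittagDensity_mul hα ENNReal.measurable_ofReal]
  have hin : ∀ φ ∈ Ioo 0 Real.pi, ∫⁻ w in Ioi 0, ENNReal.ofReal (Real.exp (-w)) *
      ENNReal.ofReal ((w / zolotarev α φ) ^ (1 - α)) ≤ 4 := by
    intro φ hφ
    calc _ ≤ ∫⁻ w in Ioi (0 : ℝ), (2 * ENNReal.ofReal (Real.exp (-w)) +
          2 * ENNReal.ofReal (Real.exp (-w) * w ^ ((2 : ℝ) - 1))) := by
          refine setLIntegral_mono (by fun_prop) fun w hw => ?_
          have hw0 : (0 : ℝ) < w := hw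
          rw [← ENNReal.ofReal_mul (Real.exp_pos _).le,
            show (2 : ℝ≥0∞) = ENNReal.ofReal 2 by norm_num, ← ENNReal.ofReal_mul zero_le_two,
            ← ENNReal.ofReal_mul zero_le_two, ← ENNReal.ofReal_add (by positivity) (by positivity)]
          refine ENNReal.ofReal_le_ofReal ?_
          have h1 := div_zolotarev_rpow_le hα hφ hw0
          have h2 := rpow_le_one_add_self hw0 (s := 1 - α) (by linarith [hα.2])
            (by linarith [hα.1])
          have h3 : w ^ ((2 : ℝ) - 1) = w := by norm_num
          rw [h3]
          calc _ ≤ Real.exp (-w) * (2 * (1 + w)) :=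
                mul_le_mul_of_nonneg_left (by linarith) (Real.exp_pos _).le
            _ = _ := by ring
      _ = 4 := by
          rw [lintegral_add_left (by fun_prop), lintegral_const_mul _ (by fun_prop),
            lintegral_const_mul _ (by fun_prop), lintegral_exp_neg,
            lintegral_exp_mul_rpow two_pos, Real.Gamma_two]
          norm_num
  calc _ ≤ ENNReal.ofReal Real.pi⁻¹ * ∫⁻ φ in Ioo 0 Real.pi, 4 :=
        mul_le_mul_right (setLIntegral_mono measurable_const hin) _
    _ = 4 := by
        simp only [lintegral_const, MeasurableSet.univ, Measure.restrict_apply, univ_inter,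
          Real.volume_Ioo, sub_zero]
        rw [mul_left_comm, ← ENNReal.ofReal_mul (inv_nonneg.2 Real.pi_pos.le),
          inv_mul_cancel₀ Real.pi_ne_zero, ENNReal.ofReal_one, mul_one]

lemma lintegral_mul_mittagDensity_mul_rpow_le {α γ : ℝ} (hα : α ∈ Ioo (0 : ℝ) 1)
    (hγ : γ ∈ Icc (0 : ℝ) 1) :
    ∫⁻ θ in Ioi 0, ENNReal.ofReal θ * mittagDensity α θ * ENNReal.ofReal (θ ^ (-γ)) ≤ 5 := by
  have hm := measurable_mittagDensity α
  calc _ ≤ ∫⁻ θ in Ioi 0, (mittagDensity α θ + ENNReal.ofReal θ * mittagDensity α θ) := by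
        refine setLIntegral_mono (by fun_prop) fun θ hθ => ?_
        have hθ0 : (0 : ℝ) < θ := hθ
        rw [mul_right_comm, ← one_add_mul, ← ENNReal.ofReal_mul hθ0.le]
        refine mul_le_mul_left ?_ _
        rw [← ENNReal.ofReal_one, ← ENNReal.ofReal_add zero_le_one hθ0.le]
        refine ENNReal.ofReal_le_ofReal ?_
        have h := rpow_le_one_add_self hθ0 (s := 1 - γ) (by linarith [hγ.2]) (by linarith [hγ.1])
        rwa [sub_eq_add_neg, Real.rpow_add hθ0, Real.rpow_one] at h
    _ ≤ 1 + 4 := by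
        rw [lintegral_add_left hm, lintegral_mittagDensity hα]
        exact add_le_add le_rfl (lintegral_mul_mittagDensity_le hα)
    _ = 5 := by norm_num

/-- Jordan's inequality `sin x ≥ 2x/π` at both endpoints reduces this to the integrability of
`x^(-δ)`. -/
lemma lintegral_sin_rpow_neg_lt_top {δ : ℝ} (hδ : δ ∈ Ioo (0 : ℝ) 1) :
    ∫⁻ φ in Ioo 0 Real.pi, ENNReal.ofReal (Real.sin φ ^ (-δ)) < ∞ := by
  have hpi := Real.pi_pos
  have i1 : IntervalIntegrable (fun x : ℝ => x ^ (-δ)) volume 0 Real.pi :=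
    intervalIntegral.intervalIntegrable_rpow' (by linarith [hδ.2])
  have i2 : IntervalIntegrable (fun x : ℝ => (Real.pi - x) ^ (-δ)) volume 0 Real.pi := by
    have := (i1.comp_sub_left Real.pi).symm
    simpa using this
  have i3 := ((i1.add i2).const_mul ((2 / Real.pi) ^ (-δ)))
  rw [intervalIntegrable_iff_integrableOn_Ioo_of_le hpi.le] at i3
  refine lt_of_le_of_lt (setLIntegral_mono_ae' measurableSet_Ioo (ae_of_all _ fun φ hφ => ?_))
    i3.lintegral_lt_top
  refine ENNReal.ofReal_le_ofReal ?_
  have p1 : 0 < φ := hφ.1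
  have p2 : 0 < Real.pi - φ := by linarith [hφ.2]
  have q1 := Real.rpow_pos_of_pos p1 (-δ)
  have q2 := Real.rpow_pos_of_pos p2 (-δ)
  have q3 : (0 : ℝ) < (2 / Real.pi) ^ (-δ) := by positivity
  have aux : ∀ x, 0 < x → x ≤ Real.pi / 2 →
      Real.sin x ^ (-δ) ≤ (2 / Real.pi) ^ (-δ) * x ^ (-δ) := by
    intro x hx hx2
    rw [← Real.mul_rpow (by positivity) hx.le]
    exact Real.rpow_le_rpow_of_nonpos (by positivity) (Real.mul_le_sin hx.le hx2)
      (by linarith [hδ.1])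
  rcases le_total φ (Real.pi / 2) with h | h
  · refine (aux φ p1 h).trans (mul_le_mul_of_nonneg_left ?_ q3.le)
    linarith
  · have := aux (Real.pi - φ) p2 (by linarith)
    rw [Real.sin_pi_sub] at this
    refine this.trans (mul_le_mul_of_nonneg_left ?_ q3.le)
    linarith

/-- From `θ ≥ sin φ · w^(1-α)` one gets `θ^(-δ) ≤ (sin φ)^(-δ) (1 + w^(-δ))`, a product of
integrable functions of `φ` and `w` free of `α`. -/
lemma exists_lintegral_mittagDensity_mul_rpow_le {δ : ℝ} (hδ : δ ∈ Ioo (0 : ℝ) 1) :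
    ∃ K : ℝ≥0∞, K < ∞ ∧ ∀ α ∈ Ioo (0 : ℝ) 1,
      ∫⁻ θ in Ioi 0, mittagDensity α θ * ENNReal.ofReal (θ ^ (-δ)) ≤ K := by
  set I := ∫⁻ φ in Ioo 0 Real.pi, ENNReal.ofReal (Real.sin φ ^ (-δ)) with hI
  set L := 1 + ENNReal.ofReal (Real.Gamma (1 - δ)) with hL
  have hI' : I < ∞ := lintegral_sin_rpow_neg_lt_top hδ
  have hL' : L < ∞ := by simp [hL]
  refine ⟨ENNReal.ofReal Real.pi⁻¹ * (I * L),
    ENNReal.mul_lt_top ENNReal.ofReal_lt_top (ENNReal.mul_lt_top hI' hL'), fun α hα => ?_⟩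
  rw [lintegral_mittagDensity_mul hα (by fun_prop)]
  refine mul_le_mul_right ?_ _
  rw [hI, ← lintegral_mul_const _ (by fun_prop)]
  refine setLIntegral_mono (by fun_prop) fun φ hφ => ?_
  have e3 : 0 < Real.sin φ := Real.sin_pos_of_pos_of_lt_pi hφ.1 hφ.2
  have hs := Real.rpow_pos_of_pos e3 (-δ)
  have hLL : L = ∫⁻ w in Ioi (0 : ℝ), (ENNReal.ofReal (Real.exp (-w)) +
      ENNReal.ofReal (Real.exp (-w) * w ^ ((1 - δ) - 1))) := by
    rw [lintegral_add_left (by fun_prop), lintegral_exp_neg,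
      lintegral_exp_mul_rpow (by linarith [hδ.2])]
  rw [hLL, ← lintegral_const_mul _ (by fun_prop)]
  refine setLIntegral_mono (by fun_prop) fun w hw => ?_
  have hw0 : (0 : ℝ) < w := hw
  have hwp : 0 < w ^ (1 - α) := Real.rpow_pos_of_pos hw0 _
  have hwd := Real.rpow_pos_of_pos hw0 (1 - δ - 1)
  rw [← ENNReal.ofReal_mul (Real.exp_pos _).le,
    ← ENNReal.ofReal_add (by positivity) (by positivity), ← ENNReal.ofReal_mul hs.le]
  refine ENNReal.ofReal_le_ofReal ?_
  have h1 : ((w / zolotarev α φ) ^ (1 - α)) ^ (-δ) ≤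
      (Real.sin φ * w ^ (1 - α)) ^ (-δ) :=
    Real.rpow_le_rpow_of_nonpos (by positivity) (le_div_zolotarev_rpow hα hφ hw0)
      (by linarith [hδ.1])
  have h2 : (w ^ (1 - α)) ^ (-δ) ≤ 1 + w ^ (1 - δ - 1) := by
    rw [← Real.rpow_mul hw0.le]
    rcases le_total w 1 with h | h
    · have : w ^ ((1 - α) * -δ) ≤ w ^ (1 - δ - 1) :=
        Real.rpow_le_rpow_of_exponent_ge hw0 h (by nlinarith [hα.1, hδ.1])
      linarith
    · have : w ^ ((1 - α) * -δ) ≤ 1 :=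
        Real.rpow_le_one_of_one_le_of_nonpos h (by nlinarith [hα.2, hδ.1])
      linarith
  rw [Real.mul_rpow e3.le hwp.le] at h1
  calc _ ≤ Real.exp (-w) * (Real.sin φ ^ (-δ) * (1 + w ^ (1 - δ - 1))) :=
        mul_le_mul_of_nonneg_left (h1.trans (mul_le_mul_of_nonneg_left h2 hs.le))
          (Real.exp_pos _).le
    _ = _ := by ring

/-- For `φ` in `(π/6, 5π/6)`, of probability `2/3`, and `w` in `(1,2)`, where the exponential
density is at least `e^(-2)`, the variable `θ` lies in `[1/2,4]`. This bounds the mass of `h_α`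
there from below for every `α`. -/
lemma le_lintegral_mittagDensity_mul {α : ℝ} (hα : α ∈ Ioo (0 : ℝ) 1) {g : ℝ → ℝ≥0∞}
    (hg : Measurable g) {m : ℝ≥0∞} (hm : ∀ θ ∈ Icc (1 / 2 : ℝ) 4, m ≤ g θ) :
    ENNReal.ofReal (2 / 3 * Real.exp (-2)) * m ≤ ∫⁻ θ in Ioi 0, mittagDensity α θ * g θ := by
  have hpi := Real.pi_pos
  rw [lintegral_mittagDensity_mul hα hg]
  have hsub : Ioo (Real.pi / 6) (Real.pi - Real.pi / 6) ⊆ Ioo 0 Real.pi :=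
    Ioo_subset_Ioo (by positivity) (by linarith)
  have hin : ∀ φ ∈ Ioo (Real.pi / 6) (Real.pi - Real.pi / 6),
      ENNReal.ofReal (Real.exp (-2)) * m ≤ ∫⁻ w in Ioi 0, ENNReal.ofReal (Real.exp (-w)) *
        g ((w / zolotarev α φ) ^ (1 - α)) := by
    intro φ hφ
    have hφ' := hsub hφ
    have hsin : 1 / 2 ≤ Real.sin φ := by
      rw [← Real.sin_pi_div_six]
      rcases le_total φ (Real.pi / 2) with h | h
      · exact Real.sin_le_sin_of_le_of_le_pi_div_two (by linarith) h hφ.1.le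
      · rw [← Real.sin_pi_sub φ]
        exact Real.sin_le_sin_of_le_of_le_pi_div_two (by linarith) (by linarith)
          (by linarith [hφ.2])
    calc ENNReal.ofReal (Real.exp (-2)) * m
        = ∫⁻ _ in Ioo (1 : ℝ) 2, ENNReal.ofReal (Real.exp (-2)) * m := by
          simp only [lintegral_const, MeasurableSet.univ, Measure.restrict_apply, univ_inter,
            Real.volume_Ioo]
          norm_num
      _ ≤ ∫⁻ w in Ioo (1 : ℝ) 2, ENNReal.ofReal (Real.exp (-w)) *
            g ((w / zolotarev α φ) ^ (1 - α)) := by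
          refine setLIntegral_mono (by fun_prop) fun w hw => ?_
          have hw0 : 0 < w := by linarith [hw.1]
          refine mul_le_mul' (ENNReal.ofReal_le_ofReal (Real.exp_le_exp.2 (by linarith [hw.2])))
            (hm _ ⟨?_, ?_⟩)
          · refine le_trans ?_ (le_div_zolotarev_rpow hα hφ' hw0)
            have := Real.one_le_rpow hw.1.le (z := 1 - α) (by linarith [hα.2])
            nlinarith
          · refine (div_zolotarev_rpow_le hα hφ' hw0).trans ?_
            have := Real.rpow_le_rpow_of_exponent_le hw.1.le (y := 1 - α) (z := 1)
              (by linarith [hα.1])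
            rw [Real.rpow_one] at this
            linarith [hw.2]
      _ ≤ _ := lintegral_mono_set fun w hw => lt_trans one_pos hw.1
  calc ENNReal.ofReal (2 / 3 * Real.exp (-2)) * m
      = ENNReal.ofReal Real.pi⁻¹ * ∫⁻ _ in Ioo (Real.pi / 6) (Real.pi - Real.pi / 6),
          ENNReal.ofReal (Real.exp (-2)) * m := by
        simp only [lintegral_const, MeasurableSet.univ, Measure.restrict_apply, univ_inter,
          Real.volume_Ioo]
        rw [mul_comm (ENNReal.ofReal (Real.exp (-2)) * m), ← mul_assoc, ← mul_assoc,
          ← ENNReal.ofReal_mul (by positivity),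
          ← ENNReal.ofReal_mul (mul_nonneg (by positivity) (by linarith))]
        congr 2
        field_simp
        ring
    _ ≤ ENNReal.ofReal Real.pi⁻¹ * ∫⁻ φ in Ioo (Real.pi / 6) (Real.pi - Real.pi / 6),
          ∫⁻ w in Ioi 0, ENNReal.ofReal (Real.exp (-w)) *
            g ((w / zolotarev α φ) ^ (1 - α)) :=
        mul_le_mul_right (setLIntegral_mono' measurableSet_Ioo hin) _
    _ ≤ _ := mul_le_mul_right (lintegral_mono_set hsub) _

/-! ### Jensen's and Minkowski's inequalities -/

/-- Jensen's inequality for the weight `a`. -/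
lemma rpow_lintegral_mul_le {S : Type*} [MeasurableSpace S] {ν : Measure S} {q : ℝ} (hq : 1 ≤ q)
    {a f : S → ℝ≥0∞} (ha : AEMeasurable a ν) (hf : AEMeasurable f ν) :
    (∫⁻ s, a s * f s ∂ν) ^ q ≤ (∫⁻ s, a s ∂ν) ^ (q - 1) * ∫⁻ s, a s * f s ^ q ∂ν := by
  rcases hq.eq_or_lt with rfl | hq1
  · simp
  have hq0 : 0 < q := by linarith
  have hc : (q / (q - 1)).HolderConjugate q := by
    refine (Real.holderConjugate_iff.2 ⟨hq1, ?_⟩).symm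
    field_simp
    ring
  -- Hölder's inequality with the weight split as `a = a^((q-1)/q) · a^(1/q)`.
  have h1 : ∀ s, a s * f s = ((fun s => a s ^ ((q - 1) / q)) * fun s => a s ^ (1 / q) * f s) s := by
    intro s
    change _ = a s ^ ((q - 1) / q) * (a s ^ (1 / q) * f s)
    rw [← mul_assoc, ← ENNReal.rpow_add_of_nonneg _ _ (div_nonneg (by linarith) hq0.le)
      (by positivity)]
    rw [show (q - 1) / q + 1 / q = 1 by field_simp; ring, ENNReal.rpow_one]
  have h2 := (lintegral_congr h1).trans_le (ENNReal.lintegral_mul_le_Lp_mul_Lq ν hc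
    (ha.pow_const ((q - 1) / q)) ((ha.pow_const (1 / q)).mul hf))
  have h3 : ∀ s, (a s ^ ((q - 1) / q)) ^ (q / (q - 1)) = a s := by
    intro s
    have : q - 1 ≠ 0 := by linarith
    rw [← ENNReal.rpow_mul, show (q - 1) / q * (q / (q - 1)) = 1 by field_simp, ENNReal.rpow_one]
  have h4 : ∀ s, (a s ^ (1 / q) * f s) ^ q = a s * f s ^ q := by
    intro s
    rw [ENNReal.mul_rpow_of_nonneg _ _ hq0.le, ← ENNReal.rpow_mul, one_div_mul_cancel hq0.ne',
      ENNReal.rpow_one]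
  simp_rw [h3, h4] at h2
  refine (ENNReal.rpow_le_rpow h2 hq0.le).trans_eq ?_
  rw [ENNReal.mul_rpow_of_nonneg _ _ hq0.le, ← ENNReal.rpow_mul, ← ENNReal.rpow_mul,
    one_div_mul_cancel hq0.ne', ENNReal.rpow_one]
  congr 2
  have : q - 1 ≠ 0 := by linarith
  field_simp

/-- Minkowski's integral inequality, with prescribed bounds of the norms. -/
lemma lintegral_rpow_lintegral_mul_le {S X : Type*} [MeasurableSpace S] [MeasurableSpace X]
    {ν : Measure S} {μ : Measure X} [SFinite ν] [SFinite μ] {q : ℝ} (hq : 1 ≤ q)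
    {a : S → ℝ≥0∞} (ha : Measurable a) {F : S → X → ℝ≥0∞} (hF : Measurable (Function.uncurry F))
    {b : S → ℝ} (hb : Measurable b) (hb0 : ∀ᵐ s ∂ν, 0 < b s) {C : ℝ≥0∞}
    (h : ∀ᵐ s ∂ν, ∫⁻ x, F s x ^ q ∂μ ≤ ENNReal.ofReal (b s) ^ q * C) :
    ∫⁻ x, (∫⁻ s, a s * F s x ∂ν) ^ q ∂μ ≤ (∫⁻ s, a s * ENNReal.ofReal (b s) ∂ν) ^ q * C := by
  have hq0 : 0 < q := by linarith
  -- Normalise `F` by its prescribed norm `b`, move `b` into the weight `w = a b`, then apply Jensen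
  -- and Tonelli.
  obtain ⟨H, hH⟩ : ∃ H : S → X → ℝ≥0∞, ∀ s x, H s x = (ENNReal.ofReal (b s))⁻¹ * F s x :=
    ⟨_, fun _ _ => rfl⟩
  obtain ⟨w, hw⟩ : ∃ w : S → ℝ≥0∞, ∀ s, w s = a s * ENNReal.ofReal (b s) := ⟨_, fun _ => rfl⟩
  simp_rw [← hw]
  set B := ∫⁻ s, w s ∂ν with hB
  have hwm : Measurable w := by
    rw [funext hw]
    exact ha.mul hb.ennreal_ofReal
  have hHm : Measurable (Function.uncurry H) := by
    have : Function.uncurry H = fun z => (ENNReal.ofReal (b z.1))⁻¹ * Function.uncurry F z := by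
      funext z
      exact hH _ _
    rw [this]
    exact ((hb.ennreal_ofReal.inv).comp measurable_fst).mul hF
  have hbne : ∀ s, 0 < b s → ENNReal.ofReal (b s) * (ENNReal.ofReal (b s))⁻¹ = 1 := fun s hs =>
    ENNReal.mul_inv_cancel (ENNReal.ofReal_pos.2 hs).ne' ENNReal.ofReal_ne_top
  have h1 : ∀ x, ∫⁻ s, a s * F s x ∂ν = ∫⁻ s, w s * H s x ∂ν := by
    intro x
    refine lintegral_congr_ae ?_
    filter_upwards [hb0] with s hs
    rw [hH, hw]
    calc a s * F s x = a s * (ENNReal.ofReal (b s) * (ENNReal.ofReal (b s))⁻¹) * F s x := by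
          rw [hbne s hs, mul_one]
      _ = _ := by ring
  have hpow : Measurable (Function.uncurry fun s x => H s x ^ q) := hHm.pow_const q
  have hjoint : Measurable fun z : X × S => w z.2 * H z.2 z.1 ^ q :=
    (hwm.comp measurable_snd).mul (hpow.comp measurable_swap)
  have h2 : ∫⁻ x, ∫⁻ s, w s * H s x ^ q ∂ν ∂μ = ∫⁻ s, w s * ∫⁻ x, H s x ^ q ∂μ ∂ν := by
    rw [lintegral_lintegral_swap (f := fun x s => w s * H s x ^ q) hjoint.aemeasurable]
    refine lintegral_congr fun s => ?_
    exact lintegral_const_mul _ (hpow.comp measurable_prodMk_left)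
  calc ∫⁻ x, (∫⁻ s, a s * F s x ∂ν) ^ q ∂μ
      ≤ ∫⁻ x, B ^ (q - 1) * ∫⁻ s, w s * H s x ^ q ∂ν ∂μ := by
        refine lintegral_mono fun x => ?_
        rw [h1 x]
        exact rpow_lintegral_mul_le hq hwm.aemeasurable
          (hHm.comp measurable_prodMk_right).aemeasurable
    _ = B ^ (q - 1) * ∫⁻ s, w s * ∫⁻ x, H s x ^ q ∂μ ∂ν := by
        rw [lintegral_const_mul _ hjoint.lintegral_prod_right', h2]
    _ ≤ B ^ (q - 1) * ∫⁻ s, w s * C ∂ν := by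
        refine mul_le_mul_right (lintegral_mono_ae ?_) _
        filter_upwards [hb0, h] with s hs hs2
        refine mul_le_mul_right ?_ _
        calc ∫⁻ x, H s x ^ q ∂μ
            = ((ENNReal.ofReal (b s))⁻¹) ^ q * ∫⁻ x, F s x ^ q ∂μ := by
              have hFs : Measurable (F s) := hF.comp measurable_prodMk_left
              rw [← lintegral_const_mul _ (hFs.pow_const q)]
              refine lintegral_congr fun x => ?_
              rw [hH]
              exact ENNReal.mul_rpow_of_nonneg _ _ hq0.le
          _ ≤ ((ENNReal.ofReal (b s))⁻¹) ^ q * (ENNReal.ofReal (b s) ^ q * C) :=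
              mul_le_mul_right hs2 _
          _ = C := by
              rw [← mul_assoc, ← ENNReal.mul_rpow_of_nonneg _ _ hq0.le, mul_comm _ (ENNReal.ofReal _),
                hbne s hs, ENNReal.one_rpow, one_mul]
    _ = B ^ q * C := by
        rw [lintegral_mul_const _ hwm, ← hB, ← mul_assoc]
        congr 1
        calc B ^ (q - 1) * B = B ^ (q - 1) * B ^ (1 : ℝ) := by rw [ENNReal.rpow_one]
          _ = B ^ q := by
            rw [← ENNReal.rpow_add_of_nonneg _ _ (by linarith) zero_le_one, sub_add_cancel]

/-! ### The heat semigroup on Lebesgue spaces -/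

lemma heatKernel_nonneg {t : ℝ} (ht : 0 < t) (x : Space N) : 0 ≤ heatKernel N t x := by
  have := Real.pi_pos
  unfold heatKernel
  positivity

lemma lintegral_heatKernel {t : ℝ} (ht : 0 < t) :
    ∫⁻ x : Space N, ENNReal.ofReal (heatKernel N t x) = 1 := by
  have hpi := Real.pi_pos
  have hb : 0 < 1 / (4 * t) := by positivity
  have h := GaussianFourier.integral_rexp_neg_mul_sq_norm (V := Space N) hb
  rw [finrank_euclideanSpace_fin, show Real.pi / (1 / (4 * t)) = 4 * Real.pi * t by field_simp] at h
  have hne : (4 * Real.pi * t) ^ ((N : ℝ) / 2) ≠ 0 := by positivity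
  have hint : Integrable fun v : Space N => Real.exp (-(1 / (4 * t)) * ‖v‖ ^ 2) := by
    by_contra hn
    rw [integral_undef hn] at h
    exact hne h.symm
  have hK : (fun x : Space N => heatKernel N t x) =
      fun x => (4 * Real.pi * t) ^ (-((N : ℝ) / 2)) * Real.exp (-(1 / (4 * t)) * ‖x‖ ^ 2) := by
    funext x
    unfold heatKernel
    congr 2
    ring
  have hKint : Integrable (heatKernel N t) volume := by
    change Integrable (fun x => heatKernel N t x) volume
    rw [hK]
    exact hint.const_mul _
  rw [← ofReal_integral_eq_lintegral_ofReal hKint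
    (ae_of_all _ fun x => heatKernel_nonneg ht x), hK, integral_const_mul, h,
    Real.rpow_neg (by positivity), inv_mul_cancel₀ hne, ENNReal.ofReal_one]

lemma lintegral_heatKernel_sub_left {t : ℝ} (ht : 0 < t) (x : Space N) :
    ∫⁻ y : Space N, ENNReal.ofReal (heatKernel N t (x - y)) = 1 := by
  rw [lintegral_sub_left_eq_self (fun y => ENNReal.ofReal (heatKernel N t y)) x]
  exact lintegral_heatKernel ht

lemma lintegral_heatKernel_sub_right {t : ℝ} (ht : 0 < t) (y : Space N) :
    ∫⁻ x : Space N, ENNReal.ofReal (heatKernel N t (x - y)) = 1 := by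
  rw [lintegral_sub_right_eq_self (fun x => ENNReal.ofReal (heatKernel N t x)) y]
  exact lintegral_heatKernel ht

lemma heatKernel_le {t : ℝ} (ht : 0 < t) (x : Space N) :
    heatKernel N t x ≤ t ^ (-((N : ℝ) / 2)) := by
  have hpi := Real.pi_gt_three
  unfold heatKernel
  calc _ ≤ (4 * Real.pi * t) ^ (-((N : ℝ) / 2)) * 1 := by
        refine mul_le_mul_of_nonneg_left (Real.exp_le_one_iff.2 ?_) (by positivity)
        exact div_nonpos_of_nonpos_of_nonneg (by nlinarith [sq_nonneg ‖x‖]) (by positivity)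
    _ ≤ _ := by
        rw [mul_one]
        exact Real.rpow_le_rpow_of_nonpos ht (by nlinarith)
          (neg_nonpos.2 (by positivity))

lemma measurable_heatKernel_sub (t : ℝ) (x : Space N) :
    Measurable fun y : Space N => ENNReal.ofReal (heatKernel N t (x - y)) :=
  (measurable_heatKernel.comp
    (measurable_const.prodMk (measurable_const.sub measurable_id))).ennreal_ofReal

lemma rpow_heat_le {t r : ℝ} (ht : 0 < t) (hr : 1 ≤ r) {f : Space N → ℝ≥0∞} (hf : Measurable f)
    (x : Space N) : heat t (volume.withDensity f) x ^ r ≤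
      ∫⁻ y, ENNReal.ofReal (heatKernel N t (x - y)) * f y ^ r := by
  rw [heat_withDensity t hf]
  refine (rpow_lintegral_mul_le hr (measurable_heatKernel_sub t x).aemeasurable
    hf.aemeasurable).trans_eq ?_
  rw [lintegral_heatKernel_sub_left ht, ENNReal.one_rpow, one_mul]

lemma heat_le_of_le {t : ℝ} (ht : 0 < t) {f : Space N → ℝ≥0∞} (hf : Measurable f) {a : ℝ≥0∞}
    (h : ∀ y, f y ≤ a) (x : Space N) : heat t (volume.withDensity f) x ≤ a := by
  rw [heat_withDensity t hf]
  calc _ ≤ ∫⁻ y, ENNReal.ofReal (heatKernel N t (x - y)) * a :=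
        lintegral_mono fun y => mul_le_mul_right (h y) _
    _ = a := by
        rw [lintegral_mul_const _ (measurable_heatKernel_sub t x),
          lintegral_heatKernel_sub_left ht, one_mul]

/-- The `L^r`-`L^q` smoothing of the heat semigroup. -/
lemma lintegral_heat_rpow_le {t r q : ℝ} (ht : 0 < t) (hr : 1 ≤ r) (hrq : r ≤ q)
    {f : Space N → ℝ≥0∞} (hf : Measurable f) :
    ∫⁻ x, heat t (volume.withDensity f) x ^ q ≤
      ENNReal.ofReal (t ^ (-((N : ℝ) / 2 * (1 / r - 1 / q)))) ^ q * (∫⁻ x, f x ^ r) ^ (q / r) := by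
  have hr0 : 0 < r := by linarith
  have hq0 : 0 < q := by linarith
  set I := ∫⁻ x, f x ^ r with hI
  have hfr : Measurable fun x => f x ^ r := hf.pow_const r
  have hsup : ∀ x, heat t (volume.withDensity f) x ^ r ≤
      ENNReal.ofReal (t ^ (-((N : ℝ) / 2))) * I := by
    intro x
    refine (rpow_heat_le ht hr hf x).trans ?_
    rw [hI, ← lintegral_const_mul _ hfr]
    exact lintegral_mono fun y =>
      mul_le_mul_left (ENNReal.ofReal_le_ofReal (heatKernel_le ht _)) _
  have hint : ∫⁻ x, heat t (volume.withDensity f) x ^ r ≤ I := by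
    refine (lintegral_mono fun x => rpow_heat_le ht hr hf x).trans_eq ?_
    rw [lintegral_lintegral_swap]
    · calc _ = ∫⁻ y, (∫⁻ x, ENNReal.ofReal (heatKernel N t (x - y))) * f y ^ r := by
            refine lintegral_congr fun y => ?_
            refine lintegral_mul_const _ ?_
            exact (measurable_heatKernel.comp (f := fun x : Space N => (t, x - y))
              (by fun_prop)).ennreal_ofReal
        _ = I := by simp_rw [lintegral_heatKernel_sub_right ht, one_mul, hI]
    · refine Measurable.aemeasurable (Measurable.mul ?_ (hfr.comp measurable_snd))
      exact (measurable_heatKernel.comp (f := fun z : Space N × Space N => (t, z.1 - z.2))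
        (by fun_prop)).ennreal_ofReal
  have hheat : Measurable fun x : Space N => heat t (volume.withDensity f) x :=
    (measurable_heat (volume.withDensity f)).comp
      (f := fun x : Space N => (t, x)) (by fun_prop)
  have hdiv : 0 ≤ q / r - 1 := by rw [sub_nonneg, one_le_div hr0]; exact hrq
  -- Interpolation: `q/r - 1` copies of `heat ^ r` are bounded pointwise by `hsup`, and the
  -- remaining one is integrated by `hint`.
  calc ∫⁻ x, heat t (volume.withDensity f) x ^ q
      = ∫⁻ x, (heat t (volume.withDensity f) x ^ r) ^ (q / r - 1) *
          heat t (volume.withDensity f) x ^ r := by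
        refine lintegral_congr fun x => ?_
        rw [← ENNReal.rpow_mul, ← ENNReal.rpow_add_of_nonneg _ _ (by positivity) hr0.le]
        congr 1
        field_simp
        ring
    _ ≤ ∫⁻ x, (ENNReal.ofReal (t ^ (-((N : ℝ) / 2))) * I) ^ (q / r - 1) *
          heat t (volume.withDensity f) x ^ r :=
        lintegral_mono fun x => mul_le_mul_left (ENNReal.rpow_le_rpow (hsup x) hdiv) _
    _ ≤ (ENNReal.ofReal (t ^ (-((N : ℝ) / 2))) * I) ^ (q / r - 1) * I := by
        rw [lintegral_const_mul _ (hheat.pow_const r)]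
        exact mul_le_mul_right hint _
    _ = _ := by
        rw [ENNReal.mul_rpow_of_nonneg _ _ hdiv, mul_assoc]
        congr 1
        · rw [ENNReal.ofReal_rpow_of_pos (by positivity), ENNReal.ofReal_rpow_of_pos (by positivity),
            ← Real.rpow_mul ht.le, ← Real.rpow_mul ht.le]
          congr 2
          field_simp
        · calc I ^ (q / r - 1) * I = I ^ (q / r - 1) * I ^ (1 : ℝ) := by rw [ENNReal.rpow_one]
            _ = _ := by rw [← ENNReal.rpow_add_of_nonneg _ _ hdiv zero_le_one, sub_add_cancel]

/-! ### Retention of heat in a ball -/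

/-- A lower bound, depending on the dimension only, of the heat content of a ball. -/
noncomputable def ballHeatBound (N : ℕ) : ℝ :=
  unitBallVolume N * (4 : ℝ) ^ (-(N : ℝ)) * (4 * Real.pi) ^ (-((N : ℝ) / 2)) *
    Real.exp (-(1 / 16))

lemma unitBallVolume_pos (N : ℕ) : 0 < unitBallVolume N :=
  ENNReal.toReal_pos (Metric.measure_ball_pos _ _ one_pos).ne' measure_ball_lt_top.ne

lemma ballHeatBound_pos (N : ℕ) : 0 < ballHeatBound N := by
  have h := unitBallVolume_pos N
  have := Real.pi_pos
  unfold ballHeatBound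
  positivity

lemma volume_ball_eq (hN : 1 ≤ N) (x : Space N) {r : ℝ} (hr : 0 ≤ r) :
    volume (Metric.ball x r) = ENNReal.ofReal (r ^ N * unitBallVolume N) := by
  have : Nontrivial (Space N) :=
    Module.nontrivial_of_finrank_pos (R := ℝ) (by rw [finrank_euclideanSpace_fin]; omega)
  rw [Measure.addHaar_ball _ _ hr, finrank_euclideanSpace_fin, ENNReal.ofReal_mul (by positivity),
    unitBallVolume, ENNReal.ofReal_toReal measure_ball_lt_top.ne]

/-- Within distance `2ρ` of `x`, where `ρ = √τ / 4`, the kernel is at least `(4πτ)^(-N/2)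
e^(-1/16)`. This region contains a ball of radius `ρ` inside `B(0,r)`, centred at `x` pulled towards
the origin, even if `x` is near the boundary; its volume, of order `τ^(N/2)`, cancels the power of
`τ`. -/
lemma heat_ball_lower_bound (hN : 1 ≤ N) {r τ : ℝ} (hr : 0 < r) (hτ : 0 < τ) (hτr : τ ≤ 4 * r ^ 2)
    {x : Space N} (hx : x ∈ Metric.ball (0 : Space N) r) {f : Space N → ℝ≥0∞} (hf : Measurable f)
    {a : ℝ≥0∞} (ha : ∀ y ∈ Metric.ball (0 : Space N) r, a ≤ f y) :
    ENNReal.ofReal (ballHeatBound N) * a ≤ heat τ (volume.withDensity f) x := by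
  have hpi := Real.pi_pos
  have hx' : ‖x‖ < r := by simpa using hx
  set ρ := Real.sqrt τ / 4 with hρ
  have hsq : Real.sqrt τ ^ 2 = τ := Real.sq_sqrt hτ.le
  have hs0 : 0 < Real.sqrt τ := Real.sqrt_pos.2 hτ
  have hs2 : Real.sqrt τ ≤ 2 * r := by
    rw [Real.sqrt_le_left (by positivity)]
    linarith
  have hρ0 : 0 < ρ := by positivity
  have hρr : ρ ≤ r / 2 := by rw [hρ]; linarith
  have hρ1 : ρ / r ≤ 1 := by rw [div_le_one hr]; linarith
  set z : Space N := (1 - ρ / r) • x with hz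
  have hzx : ‖x - z‖ ≤ ρ := by
    have : x - z = (ρ / r) • x := by rw [hz, sub_smul, one_smul, sub_sub_cancel]
    rw [this, norm_smul, Real.norm_of_nonneg (by positivity)]
    calc ρ / r * ‖x‖ ≤ ρ / r * r := mul_le_mul_of_nonneg_left hx'.le (by positivity)
      _ = ρ := by field_simp
  have hz0 : ‖z‖ ≤ r - ρ := by
    rw [hz, norm_smul, Real.norm_of_nonneg (by linarith)]
    calc (1 - ρ / r) * ‖x‖ ≤ (1 - ρ / r) * r :=
          mul_le_mul_of_nonneg_left hx'.le (by linarith)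
      _ = r - ρ := by field_simp
  have hker : ∀ y ∈ Metric.ball z ρ,
      (4 * Real.pi * τ) ^ (-((N : ℝ) / 2)) * Real.exp (-(1 / 16)) ≤ heatKernel N τ (x - y) := by
    intro y hy
    rw [Metric.mem_ball, dist_eq_norm] at hy
    have hxy : ‖x - y‖ ≤ 2 * ρ := by
      have h3 : x - y = (x - z) - (y - z) := by abel
      rw [h3]
      exact (norm_sub_le _ _).trans (by linarith)
    unfold heatKernel
    refine mul_le_mul_of_nonneg_left (Real.exp_le_exp.2 ?_) (by positivity)
    rw [neg_div, neg_le_neg_iff, div_le_iff₀ (by positivity)]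
    have : ‖x - y‖ ^ 2 ≤ (2 * ρ) ^ 2 := pow_le_pow_left₀ (norm_nonneg _) hxy 2
    calc ‖x - y‖ ^ 2 ≤ (2 * ρ) ^ 2 := this
      _ = Real.sqrt τ ^ 2 / 4 := by rw [hρ]; ring
      _ = 1 / 16 * (4 * τ) := by rw [hsq]; ring
  rw [heat_withDensity τ hf]
  calc ENNReal.ofReal (ballHeatBound N) * a
      = ∫⁻ _ in Metric.ball z ρ, ENNReal.ofReal ((4 * Real.pi * τ) ^ (-((N : ℝ) / 2)) *
          Real.exp (-(1 / 16))) * a := by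
        simp only [lintegral_const, MeasurableSet.univ, Measure.restrict_apply, univ_inter]
        rw [volume_ball_eq hN z hρ0.le, mul_right_comm, ← ENNReal.ofReal_mul (by positivity)]
        congr 2
        unfold ballHeatBound
        have h1 : ρ ^ N = τ ^ ((N : ℝ) / 2) * (4 : ℝ) ^ (-(N : ℝ)) := by
          rw [hρ, div_pow, ← Real.rpow_natCast (Real.sqrt τ), Real.sqrt_eq_rpow,
            ← Real.rpow_mul hτ.le, Real.rpow_neg (by norm_num), Real.rpow_natCast,
            div_eq_mul_inv]
          congr 2
          ring
        have h2 : τ ^ (-((N : ℝ) / 2)) * τ ^ ((N : ℝ) / 2) = 1 := by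
          rw [← Real.rpow_add hτ]; simp
        rw [h1, Real.mul_rpow (by positivity) hτ.le]
        linear_combination (-(unitBallVolume N * (4 : ℝ) ^ (-(N : ℝ)) *
          (4 * Real.pi) ^ (-((N : ℝ) / 2)) * Real.exp (-(1 / 16)))) * h2
    _ ≤ ∫⁻ y in Metric.ball z ρ, ENNReal.ofReal (heatKernel N τ (x - y)) * f y := by
        refine setLIntegral_mono ((measurable_heatKernel_sub τ x).mul hf) fun y hy => ?_
        refine mul_le_mul' (ENNReal.ofReal_le_ofReal (hker y hy)) (ha y ?_)
        rw [Metric.mem_ball, dist_eq_norm] at hy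
        rw [mem_ball_zero_iff]
        calc ‖y‖ = ‖(y - z) + z‖ := by rw [sub_add_cancel]
          _ ≤ ‖y - z‖ + ‖z‖ := norm_add_le _ _
          _ < r := by linarith
    _ ≤ _ := setLIntegral_le_lintegral _ _

/-! ### Singular time integrals -/

lemma lintegral_sub_rpow {a t c : ℝ} (hat : a ≤ t) (hc : -1 < c) :
    ∫⁻ s in Ioo a t, ENNReal.ofReal ((t - s) ^ c) =
      ENNReal.ofReal ((t - a) ^ (c + 1) / (c + 1)) := by
  have i1 : IntervalIntegrable (fun x : ℝ => x ^ c) volume (t - a) (t - t) :=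
    intervalIntegral.intervalIntegrable_rpow' hc
  have i2 := i1.comp_sub_left t
  simp only [sub_sub_cancel] at i2
  have i3 := i2
  rw [intervalIntegrable_iff_integrableOn_Ioo_of_le hat] at i3
  rw [← ofReal_integral_eq_lintegral_ofReal i3]
  · congr 1
    rw [← integral_Ioc_eq_integral_Ioo, ← intervalIntegral.integral_of_le hat,
      intervalIntegral.integral_comp_sub_left (fun x : ℝ => x ^ c) t, sub_self,
      integral_rpow (Or.inl hc), Real.zero_rpow (by linarith), sub_zero]
  · filter_upwards [ae_restrict_mem measurableSet_Ioo] with s hs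
    exact Real.rpow_nonneg (by linarith [hs.2]) _

lemma lintegral_rpow_Ioo {t c : ℝ} (ht : 0 ≤ t) (hc : -1 < c) :
    ∫⁻ s in Ioo 0 t, ENNReal.ofReal (s ^ c) = ENNReal.ofReal (t ^ (c + 1) / (c + 1)) := by
  have i1 : IntervalIntegrable (fun x : ℝ => x ^ c) volume 0 t :=
    intervalIntegral.intervalIntegrable_rpow' hc
  rw [intervalIntegrable_iff_integrableOn_Ioo_of_le ht] at i1
  rw [← ofReal_integral_eq_lintegral_ofReal i1]
  · congr 1
    rw [← integral_Ioc_eq_integral_Ioo, ← intervalIntegral.integral_of_le ht,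
      integral_rpow (Or.inl hc), Real.zero_rpow (by linarith), sub_zero]
  · filter_upwards [ae_restrict_mem measurableSet_Ioo] with s hs
    exact Real.rpow_nonneg hs.1.le _

/-- On either side of `t/2` one of the two factors is away from its singularity and is bounded by
its value at `t/2`. -/
lemma sub_rpow_mul_rpow_le {t s m e : ℝ} (hs : s ∈ Ioo 0 t) (hm : m ≤ 1) (he : 0 ≤ e) :
    (t - s) ^ (m - 1) * s ^ (-e) ≤
      (t / 2) ^ (m - 1) * s ^ (-e) + (t / 2) ^ (-e) * (t - s) ^ (m - 1) := by
  have h0 : 0 < s := hs.1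
  have h1 : 0 < t - s := by linarith [hs.2]
  have h2 : 0 < t / 2 := by linarith
  have q1 := Real.rpow_pos_of_pos h0 (-e)
  have q2 := Real.rpow_pos_of_pos h1 (m - 1)
  have q3 := Real.rpow_pos_of_pos h2 (-e)
  have q4 := Real.rpow_pos_of_pos h2 (m - 1)
  rcases le_total s (t / 2) with h | h
  · have := Real.rpow_le_rpow_of_nonpos h2 (by linarith : t / 2 ≤ t - s)
      (by linarith : m - 1 ≤ 0)
    nlinarith [mul_le_mul_of_nonneg_right this q1.le, mul_pos q3 q2]
  · have := Real.rpow_le_rpow_of_nonpos h2 h (by linarith : -e ≤ 0)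
    nlinarith [mul_le_mul_of_nonneg_right this q2.le, mul_pos q4 q1]

/-- A bound of the Beta integral. -/
lemma lintegral_sub_rpow_mul_rpow_le {t m e : ℝ} (ht : 0 < t) (hm : m ∈ Ioc (0 : ℝ) 1)
    (he : e ∈ Ico (0 : ℝ) 1) :
    ∫⁻ s in Ioo 0 t, ENNReal.ofReal ((t - s) ^ (m - 1) * s ^ (-e)) ≤
      ENNReal.ofReal (2 * (1 / (1 - e) + 1 / m) * t ^ (m - e)) := by
  have h2 : 0 < t / 2 := by linarith
  have he1 : 0 < 1 - e := by linarith [he.2]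
  have hm0 : 0 < m := hm.1
  have q3 := Real.rpow_pos_of_pos h2 (-e)
  have q4 := Real.rpow_pos_of_pos h2 (m - 1)
  calc _ ≤ ∫⁻ s in Ioo 0 t, (ENNReal.ofReal ((t / 2) ^ (m - 1)) * ENNReal.ofReal (s ^ (-e)) +
          ENNReal.ofReal ((t / 2) ^ (-e)) * ENNReal.ofReal ((t - s) ^ (m - 1))) := by
        refine setLIntegral_mono (by fun_prop) fun s hs => ?_
        have q1 := Real.rpow_pos_of_pos hs.1 (-e)
        have q2 := Real.rpow_pos_of_pos (sub_pos.2 hs.2) (m - 1)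
        rw [← ENNReal.ofReal_mul q4.le, ← ENNReal.ofReal_mul q3.le,
          ← ENNReal.ofReal_add (by positivity) (by positivity)]
        exact ENNReal.ofReal_le_ofReal (sub_rpow_mul_rpow_le hs hm.2 he.1)
    _ = ENNReal.ofReal ((t / 2) ^ (m - 1) * (t ^ (1 - e) / (1 - e)) +
          (t / 2) ^ (-e) * (t ^ m / m)) := by
        rw [lintegral_add_left (by fun_prop), lintegral_const_mul _ (by fun_prop),
          lintegral_const_mul _ (by fun_prop), lintegral_rpow_Ioo ht.le (by linarith),
          lintegral_sub_rpow ht.le (by linarith), ← ENNReal.ofReal_mul q4.le,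
          ← ENNReal.ofReal_mul q3.le, sub_zero, neg_add_eq_sub, sub_add_cancel,
          ← ENNReal.ofReal_add (by positivity) (by positivity)]
    _ ≤ _ := by
        refine ENNReal.ofReal_le_ofReal ?_
        have e1 : (t / 2) ^ (m - 1) * t ^ (1 - e) = 2 ^ (1 - m) * t ^ (m - e) := by
          rw [Real.div_rpow ht.le zero_le_two, show (1 : ℝ) - m = -(m - 1) by ring,
            Real.rpow_neg zero_le_two, show m - e = (m - 1) + (1 - e) by ring, Real.rpow_add ht]
          ring
        have e2 : (t / 2) ^ (-e) * t ^ m = 2 ^ e * t ^ (m - e) := by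
          rw [Real.div_rpow ht.le zero_le_two, Real.rpow_neg zero_le_two,
            show m - e = (-e) + m by ring, Real.rpow_add ht]
          field_simp
        have f1 : (2 : ℝ) ^ (1 - m) ≤ 2 := by
          simpa using Real.rpow_le_rpow_of_exponent_le one_le_two (by linarith : 1 - m ≤ 1)
        have f2 : (2 : ℝ) ^ e ≤ 2 := by
          simpa using Real.rpow_le_rpow_of_exponent_le one_le_two he.2.le
        have ht1 := Real.rpow_pos_of_pos ht (m - e)
        calc _ = (2 ^ (1 - m) * (1 / (1 - e)) + 2 ^ e * (1 / m)) * t ^ (m - e) := by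
              rw [← mul_div_assoc, ← mul_div_assoc, e1, e2]; ring
          _ ≤ (2 * (1 / (1 - e)) + 2 * (1 / m)) * t ^ (m - e) := by gcongr
          _ = _ := by ring

/-- The relation `hrel` makes the Duhamel term decay at the same rate `t^(-αδ)` as the linear one.
The prefactor `α` cancels the `1/α` in the Beta bound, so the constant does not depend on `α`. -/
lemma duhamel_weight_le {α γ δ p t : ℝ} (hα : α ∈ Ioo (0 : ℝ) 1) (hγ : γ ∈ Ico (0 : ℝ) 1)
    (hδ : 0 < δ) (hp : 0 < p) (hδp : δ * p < 1) (hrel : 1 - γ - δ * p = -δ) (ht : 0 < t) :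
    ENNReal.ofReal α * ∫⁻ s in Ioo 0 t, ENNReal.ofReal ((t - s) ^ (α - 1)) *
      ENNReal.ofReal ((t - s) ^ (-(α * γ)) * s ^ (-(α * δ * p))) ≤
    ENNReal.ofReal (2 * (1 / (1 - δ * p) + 1 / (1 - γ))) * ENNReal.ofReal (t ^ (-(α * δ))) := by
  have hα0 := hα.1
  have hγ1 : 0 < 1 - γ := by linarith [hγ.2]
  have hδp0 : 0 < δ * p := mul_pos hδ hp
  have he : α * δ * p ≤ δ * p := by nlinarith [hα.2]
  have h1 : ∫⁻ s in Ioo 0 t, ENNReal.ofReal ((t - s) ^ (α - 1)) *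
      ENNReal.ofReal ((t - s) ^ (-(α * γ)) * s ^ (-(α * δ * p))) =
      ∫⁻ s in Ioo 0 t, ENNReal.ofReal ((t - s) ^ (α * (1 - γ) - 1) * s ^ (-(α * δ * p))) := by
    refine setLIntegral_congr_fun measurableSet_Ioo fun s hs => ?_
    have hts : 0 < t - s := sub_pos.2 hs.2
    rw [← ENNReal.ofReal_mul (by positivity), ← mul_assoc, ← Real.rpow_add hts,
      show α - 1 + -(α * γ) = α * (1 - γ) - 1 by ring]
  have hte : α * (1 - γ) - α * δ * p = -(α * δ) := by linear_combination α * hrel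
  rw [h1]
  calc _ ≤ ENNReal.ofReal α * ENNReal.ofReal (2 * (1 / (1 - α * δ * p) + 1 / (α * (1 - γ))) *
          t ^ (α * (1 - γ) - α * δ * p)) :=
        mul_le_mul_right (lintegral_sub_rpow_mul_rpow_le ht
          ⟨by positivity, by nlinarith [hα.2, hγ.1]⟩ ⟨by positivity, by linarith⟩) _
    _ ≤ _ := by
        rw [hte, ← ENNReal.ofReal_mul hα0.le, ← ENNReal.ofReal_mul (by
          have : 0 < 1 - δ * p := by linarith
          positivity), ← mul_assoc]
        refine ENNReal.ofReal_le_ofReal (mul_le_mul_of_nonneg_right ?_ (by positivity))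
        have h2 : 1 / (1 - α * δ * p) ≤ 1 / (1 - δ * p) :=
          one_div_le_one_div_of_le (by linarith) (by linarith)
        have h3 : α * (1 / (α * (1 - γ))) = 1 / (1 - γ) := by field_simp
        have h4 : 0 < 1 / (1 - α * δ * p) := one_div_pos.2 (by linarith)
        have h5 : α * (1 / (1 - α * δ * p)) ≤ 1 / (1 - α * δ * p) := by nlinarith [hα.2]
        calc _ = 2 * (α * (1 / (1 - α * δ * p)) + α * (1 / (α * (1 - γ)))) := by ring
          _ ≤ _ := by rw [h3]; linarith

/-! ### Decay estimates and global solutions for small data -/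

lemma measurable_lintegral_mul {S X : Type*} [MeasurableSpace S] [MeasurableSpace X]
    {ν : Measure S} [SFinite ν] {a : S → ℝ≥0∞} (ha : Measurable a) {F : S → X → ℝ≥0∞}
    (hF : Measurable (Function.uncurry F)) : Measurable fun x => ∫⁻ s, a s * F s x ∂ν := by
  have h : Measurable fun z : X × S => a z.2 * F z.2 z.1 :=
    (ha.comp measurable_snd).mul (hF.comp measurable_swap)
  exact h.lintegral_prod_right'

/-- Smoothing by averages over `θ` of `e^{t^α θ Δ}`. -/
lemma lintegral_subordinated_heat_rpow_le {α t r q : ℝ} (ht : 0 < t) (hr : 1 ≤ r) (hrq : r ≤ q)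
    {a : ℝ → ℝ≥0∞} (ha : Measurable a) {f : Space N → ℝ≥0∞} (hf : Measurable f) {δ : ℝ}
    (hδ : (N : ℝ) / 2 * (1 / r - 1 / q) = δ) {K : ℝ≥0∞}
    (hK : ∫⁻ θ in Ioi 0, a θ * ENNReal.ofReal (θ ^ (-δ)) ≤ K) :
    ∫⁻ x, (∫⁻ θ in Ioi 0, a θ * heat (t ^ α * θ) (volume.withDensity f) x) ^ q ≤
      (K * ENNReal.ofReal (t ^ (-(α * δ)))) ^ q * (∫⁻ x, f x ^ r) ^ (q / r) := by
  have hta : 0 < t ^ α := Real.rpow_pos_of_pos ht α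
  have hb : Measurable fun θ : ℝ => (t ^ α * θ) ^ (-δ) := by fun_prop
  have h := lintegral_rpow_lintegral_mul_le (ν := (volume : Measure ℝ).restrict (Ioi 0))
    (μ := (volume : Measure (Space N))) (hr.trans hrq) ha
    (F := fun θ x => heat (t ^ α * θ) (volume.withDensity f) x)
    ((measurable_heat (volume.withDensity f)).comp
      (f := fun z : ℝ × Space N => (t ^ α * z.1, z.2)) (by fun_prop)) hb
    (C := (∫⁻ x, f x ^ r) ^ (q / r)) ?_ ?_
  · refine h.trans (mul_le_mul_left (ENNReal.rpow_le_rpow ?_ (by linarith)) _)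
    calc _ = ∫⁻ θ in Ioi 0, a θ * ENNReal.ofReal (θ ^ (-δ)) * ENNReal.ofReal (t ^ (-(α * δ))) := by
          refine setLIntegral_congr_fun measurableSet_Ioi fun θ hθ => ?_
          have hθ0 : (0 : ℝ) < θ := hθ
          rw [Real.mul_rpow hta.le hθ0.le, ← Real.rpow_mul ht.le, mul_assoc,
            ← ENNReal.ofReal_mul (by positivity), mul_comm (θ ^ (-δ)), mul_neg]
      _ = (∫⁻ θ in Ioi 0, a θ * ENNReal.ofReal (θ ^ (-δ))) * ENNReal.ofReal (t ^ (-(α * δ))) :=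
          lintegral_mul_const _ (by fun_prop)
      _ ≤ _ := mul_le_mul_left hK _
  · filter_upwards [ae_restrict_mem measurableSet_Ioi] with θ hθ
    have hθ0 : (0 : ℝ) < θ := hθ
    positivity
  · filter_upwards [ae_restrict_mem measurableSet_Ioi] with θ hθ
    have hθ0 : (0 : ℝ) < θ := hθ
    have := lintegral_heat_rpow_le (mul_pos hta hθ0) hr hrq hf
    rwa [hδ] at this

/-- Minkowski in `s`: `S_α(t-s)` maps `L^(q/p)` to `L^q` with norm at most `5 (t-s)^(-αγ)`, and the
`L^(q/p)` norm of `u(s)^p` is the `p`-th power of the `L^q` norm of `u(s)`. -/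
lemma lintegral_duhamel_integral_rpow_le {α p q γ δ t : ℝ} (hα : α ∈ Ioo (0 : ℝ) 1) (hp : 1 < p)
    (hq1 : 1 ≤ q) (hpq : p ≤ q) (hγ : γ ∈ Ico (0 : ℝ) 1)
    (hγd : (N : ℝ) / 2 * (1 / (q / p) - 1 / q) = γ) {M : ℝ≥0∞}
    {u : ℝ → Space N → ℝ≥0∞} (hu : Measurable (Function.uncurry u))
    (huM : ∀ s, 0 < s → ∫⁻ x, u s x ^ q ≤ (M * ENNReal.ofReal (s ^ (-(α * δ)))) ^ q) :
    ∫⁻ x, (∫⁻ s in Ioo 0 t, ENNReal.ofReal ((t - s) ^ (α - 1)) *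
        opS α (t - s) (volume.withDensity fun y => u s y ^ p) x) ^ q ≤
      (∫⁻ s in Ioo 0 t, ENNReal.ofReal ((t - s) ^ (α - 1)) *
        ENNReal.ofReal ((t - s) ^ (-(α * γ)) * s ^ (-(α * δ * p)))) ^ q * (5 * M ^ p) ^ q := by
  have hq0 : 0 < q := by linarith
  have hp0 : 0 < p := by linarith
  have hup : Measurable (Function.uncurry fun (s : ℝ) (y : Space N) => u s y ^ p) :=
    hu.pow_const p
  have hFm : Measurable (Function.uncurry fun (s : ℝ) (x : Space N) =>
      opS α (t - s) (volume.withDensity fun y => u s y ^ p) x) :=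
    (measurable_opS_withDensity α hup).comp (f := fun z : ℝ × Space N =>
      (t - z.1, z.1, z.2)) (by fun_prop)
  refine lintegral_rpow_lintegral_mul_le (ν := (volume : Measure ℝ).restrict (Ioo 0 t))
    (a := fun s => ENNReal.ofReal ((t - s) ^ (α - 1)))
    (b := fun s => (t - s) ^ (-(α * γ)) * s ^ (-(α * δ * p)))
    (C := (5 * M ^ p) ^ q) hq1 (by fun_prop) hFm (by fun_prop) ?_ ?_
  · filter_upwards [ae_restrict_mem measurableSet_Ioo] with s hs
    have h1 : 0 < s := hs.1
    have h2 : 0 < t - s := sub_pos.2 hs.2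
    positivity
  · filter_upwards [ae_restrict_mem measurableSet_Ioo] with s hs
    have h1 : 0 < s := hs.1
    have h2 : 0 < t - s := sub_pos.2 hs.2
    have hqp : 1 ≤ q / p := (one_le_div hp0).2 hpq
    have hqp2 : q / p ≤ q := div_le_self hq0.le hp.le
    have hus : Measurable fun y => u s y ^ p := hup.comp measurable_prodMk_left
    have hin : ∫⁻ x, (u s x ^ p) ^ (q / p) = ∫⁻ x, u s x ^ q := by
      refine lintegral_congr fun x => ?_
      rw [← ENNReal.rpow_mul, mul_div_cancel₀ _ hp0.ne']
    refine (lintegral_subordinated_heat_rpow_le h2 hqp hqp2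
      (ENNReal.measurable_ofReal.mul (measurable_mittagDensity α)) hus hγd
      (lintegral_mul_mittagDensity_mul_rpow_le hα ⟨hγ.1, hγ.2.le⟩)).trans ?_
    rw [hin, show q / (q / p) = p by field_simp]
    calc _ ≤ (5 * ENNReal.ofReal ((t - s) ^ (-(α * γ)))) ^ q *
          ((M * ENNReal.ofReal (s ^ (-(α * δ)))) ^ q) ^ p :=
          mul_le_mul_right (ENNReal.rpow_le_rpow (huM s h1) hp0.le) _
      _ = _ := by
          rw [← ENNReal.rpow_mul, mul_comm q p, ENNReal.rpow_mul,
            ← ENNReal.mul_rpow_of_nonneg _ _ hq0.le, ← ENNReal.mul_rpow_of_nonneg _ _ hq0.le,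
            ENNReal.mul_rpow_of_nonneg _ _ hp0.le, ENNReal.ofReal_rpow_of_pos (by positivity),
            ← Real.rpow_mul h1.le, neg_mul, ENNReal.ofReal_mul (by positivity)]
          ring_nf

/-- The decay estimate is stable under the integral equation. -/
lemma lintegral_duhamel_rpow_le {α p q r γ δ t : ℝ} (hα : α ∈ Ioo (0 : ℝ) 1) (hp : 1 < p)
    (hr : 1 ≤ r) (hrq : r ≤ q) (hpq : p ≤ q) (hγ : γ ∈ Ico (0 : ℝ) 1) (hδ0 : 0 < δ)
    (hδp : δ * p < 1) (hrel : 1 - γ - δ * p = -δ)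
    (hδ : (N : ℝ) / 2 * (1 / r - 1 / q) = δ) (hγd : (N : ℝ) / 2 * (1 / (q / p) - 1 / q) = γ)
    {K Λ M : ℝ≥0∞} (hK : ∫⁻ θ in Ioi 0, mittagDensity α θ * ENNReal.ofReal (θ ^ (-δ)) ≤ K)
    {f : Space N → ℝ≥0∞} (hf : Measurable f) (hfΛ : ∫⁻ x, f x ^ r ≤ Λ ^ r)
    {u : ℝ → Space N → ℝ≥0∞} (hu : Measurable (Function.uncurry u))
    (huM : ∀ s, 0 < s → ∫⁻ x, u s x ^ q ≤ (M * ENNReal.ofReal (s ^ (-(α * δ)))) ^ q)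
    (ht : 0 < t) :
    ∫⁻ x, duhamel α p (volume.withDensity f) u t x ^ q ≤
      ((K * Λ + ENNReal.ofReal (2 * (1 / (1 - δ * p) + 1 / (1 - γ))) * (5 * M ^ p)) *
        ENNReal.ofReal (t ^ (-(α * δ)))) ^ q := by
  have hq1 : 1 ≤ q := hr.trans hrq
  have hq0 : 0 < q := by linarith
  have hp0 : 0 < p := by linarith
  have hr0 : 0 < r := by linarith
  set X := ENNReal.ofReal (t ^ (-(α * δ))) with hX
  set Kd := ENNReal.ofReal (2 * (1 / (1 - δ * p) + 1 / (1 - γ))) with hKd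
  have hup : Measurable (Function.uncurry fun (s : ℝ) (y : Space N) => u s y ^ p) :=
    hu.pow_const p
  have hP : ∫⁻ x, opP α t (volume.withDensity f) x ^ q ≤ (K * Λ * X) ^ q := by
    refine (lintegral_subordinated_heat_rpow_le ht hr hrq (measurable_mittagDensity α) hf hδ
      hK).trans ?_
    calc _ ≤ (K * X) ^ q * (Λ ^ r) ^ (q / r) :=
          mul_le_mul_right (ENNReal.rpow_le_rpow hfΛ (by positivity)) _
      _ = _ := by
          rw [← ENNReal.rpow_mul, mul_div_cancel₀ _ hr0.ne', ← ENNReal.mul_rpow_of_nonneg _ _ hq0.le]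
          ring_nf
  obtain ⟨I, hI⟩ : ∃ I, I = ∫⁻ s in Ioo 0 t, ENNReal.ofReal ((t - s) ^ (α - 1)) *
    ENNReal.ofReal ((t - s) ^ (-(α * γ)) * s ^ (-(α * δ * p))) := ⟨_, rfl⟩
  obtain ⟨J, hJ⟩ : ∃ J : Space N → ℝ≥0∞, ∀ x, J x = ∫⁻ s in Ioo 0 t,
    ENNReal.ofReal ((t - s) ^ (α - 1)) *
      opS α (t - s) (volume.withDensity fun y => u s y ^ p) x := ⟨_, fun _ => rfl⟩
  have hFm : Measurable (Function.uncurry fun (s : ℝ) (x : Space N) =>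
      opS α (t - s) (volume.withDensity fun y => u s y ^ p) x) :=
    (measurable_opS_withDensity α hup).comp (f := fun z : ℝ × Space N =>
      (t - z.1, z.1, z.2)) (by fun_prop)
  have hJm : Measurable J := by
    rw [funext hJ]
    exact measurable_lintegral_mul (by fun_prop) hFm
  have hS : ∫⁻ x, J x ^ q ≤ I ^ q * (5 * M ^ p) ^ q := by
    simp_rw [hJ]
    rw [hI]
    exact lintegral_duhamel_integral_rpow_le hα hp hq1 hpq hγ hγd hu huM
  have hS2 : ∫⁻ x, (ENNReal.ofReal α * J x) ^ q ≤ (Kd * (5 * M ^ p) * X) ^ q := by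
    calc _ = ENNReal.ofReal α ^ q * ∫⁻ x, J x ^ q := by
          rw [← lintegral_const_mul _ (hJm.pow_const q)]
          exact lintegral_congr fun x => ENNReal.mul_rpow_of_nonneg _ _ hq0.le
      _ ≤ _ := mul_le_mul_right hS _
      _ = (ENNReal.ofReal α * I * (5 * M ^ p)) ^ q := by
          rw [ENNReal.mul_rpow_of_nonneg (_ * I) _ hq0.le, ENNReal.mul_rpow_of_nonneg _ I hq0.le,
            mul_assoc]
      _ ≤ (Kd * X * (5 * M ^ p)) ^ q := by
          refine ENNReal.rpow_le_rpow (mul_le_mul_left ?_ _) hq0.le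
          rw [hI]
          exact duhamel_weight_le hα hγ hδ0 hp0 hδp hrel ht
      _ = _ := by rw [mul_right_comm]
  have hPm : Measurable fun x : Space N => opP α t (volume.withDensity f) x :=
    (measurable_opP α (volume.withDensity f)).comp
      (f := fun x : Space N => (t, x)) (by fun_prop)
  have hadd := ENNReal.lintegral_Lp_add_le (μ := (volume : Measure (Space N)))
    hPm.aemeasurable (hJm.const_mul (ENNReal.ofReal α)).aemeasurable hq1
  have hroot : ∀ {A B : ℝ≥0∞}, A ≤ B ^ q → A ^ (1 / q) ≤ B := fun {A B} h => by
    refine (ENNReal.rpow_le_rpow h (by positivity)).trans_eq ?_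
    rw [← ENNReal.rpow_mul, mul_one_div_cancel hq0.ne', ENNReal.rpow_one]
  have hfin := hadd.trans (add_le_add (hroot hP) (hroot hS2))
  have hfin2 := ENNReal.rpow_le_rpow hfin hq0.le
  rw [← ENNReal.rpow_mul, one_div_mul_cancel hq0.ne', ENNReal.rpow_one, ← add_mul] at hfin2
  have hd : ∀ x, duhamel α p (volume.withDensity f) u t x =
      opP α t (volume.withDensity f) x + ENNReal.ofReal α * J x := fun x => by
    rw [hJ]
    rfl
  simp_rw [hd]
  exact hfin2

/-- Bounds on `L^q` norms uniform in `n` pass to the supremum by monotone convergence, slice by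
slice in time. -/
lemma ae_picardLimit_lt_top {α p q : ℝ} (hq : 0 < q) (hp : 0 ≤ p) {μ : Measure (Space N)}
    [SFinite μ] {B : ℝ → ℝ≥0∞} (hB : ∀ t, 0 < t → B t < ∞)
    (h : ∀ n t, 0 < t → ∫⁻ x, picard α p μ n t x ^ q ≤ B t) (T : ℝ) :
    ∀ᵐ z ∂(slab N T), picardLimit α p μ z.1 z.2 < ∞ := by
  unfold slab
  rw [Measure.ae_prod_iff_ae_ae]
  · filter_upwards [ae_restrict_mem measurableSet_Ioc] with t ht
    have hm : ∀ n, Measurable fun x => picard α p μ n t x ^ q := fun n =>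
      ((measurable_picard α p μ n).comp measurable_prodMk_left).pow_const q
    have hsup : ∫⁻ x, picardLimit α p μ t x ^ q ≤ B t := by
      have hpow : ∀ x, picardLimit α p μ t x ^ q = ⨆ n, picard α p μ n t x ^ q := fun x =>
        (ENNReal.orderIsoRpow q hq).map_iSup _
      simp_rw [hpow]
      rw [lintegral_iSup hm fun m n hmn x =>
        ENNReal.rpow_le_rpow (monotone_picard hp α μ t x hmn) hq.le]
      exact iSup_le fun n => h n t ht.1
    have hlim : Measurable fun x => picardLimit α p μ t x ^ q :=
      ((measurable_picardLimit α p μ).comp measurable_prodMk_left).pow_const q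
    filter_upwards [ae_lt_top hlim (hsup.trans_lt (hB t ht.1)).ne] with x hx
    exact (ENNReal.rpow_lt_top_iff_of_pos hq).1 hx
  · exact measurableSet_lt (measurable_picardLimit α p μ) measurable_const

/-- Global solvability for small data in `L^{N(p-1)/2}`, uniformly in `α`. -/
lemma exists_hasGlobalSolution_of_small (hN : 1 ≤ N) {p : ℝ} (hp : fujitaExponent N < p) :
    ∃ ε : ℝ, 0 < ε ∧ ∀ α ∈ Ioo (0 : ℝ) 1, ∀ f : Space N → ℝ≥0∞, Measurable f →
      ∫⁻ x, f x ^ ((N : ℝ) * (p - 1) / 2) ≤ ENNReal.ofReal ε ^ ((N : ℝ) * (p - 1) / 2) →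
      HasGlobalSolution α p (volume.withDensity f) := by
  have hN0 : (0 : ℝ) < N := by exact_mod_cast hN
  have hp' : 1 + 2 / (N : ℝ) < p := hp
  have hp1 : 1 < p := lt_trans (by linarith [div_pos two_pos hN0]) hp'
  have hpm : 0 < p - 1 := by linarith
  set r : ℝ := (N : ℝ) * (p - 1) / 2 with hrdef
  have hr : 1 < r := by
    have : 2 / (N : ℝ) < p - 1 := by linarith
    rw [div_lt_iff₀ hN0] at this
    rw [hrdef]
    linarith
  have hr0 : 0 < r := by linarith
  -- `q > p` puts `u^p` in `L^(q/p)` with `q/p > 1`; `q > r` gives `γ < 1` and `δ > 0`; `q < p r`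
  -- gives `δ p < 1`, the integrability of `s^(-αδp)` at `0`. The interval is nonempty because `r >
  -- 1`, that is, `p > p_F`.
  obtain ⟨q, hq1, hq2⟩ : ∃ q, max p r < q ∧ q < p * r :=
    exists_between (max_lt (by nlinarith) (by nlinarith))
  have hpq : p < q := (le_max_left _ _).trans_lt hq1
  have hrq : r < q := (le_max_right _ _).trans_lt hq1
  have hq0 : 0 < q := by linarith
  set γ : ℝ := r / q with hγdef
  set δ : ℝ := (1 - γ) / (p - 1) with hδdef
  have hγ0 : 0 < γ := div_pos hr0 hq0
  have hγ1 : γ < 1 := (div_lt_one hq0).2 hrq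
  have hδ0 : 0 < δ := div_pos (by linarith) hpm
  have hrel : 1 - γ - δ * p = -δ := by
    have : δ * (p - 1) = 1 - γ := by rw [hδdef]; field_simp
    linear_combination -this
  have hγp : 1 < γ * p := by
    rw [hγdef, div_mul_eq_mul_div, one_lt_div hq0]
    linarith
  have hδp : δ * p < 1 := by
    rw [hδdef, div_mul_eq_mul_div, div_lt_one hpm]
    linarith
  have hδ1 : δ < 1 := by nlinarith
  have hNr : (N : ℝ) = 2 * r / (p - 1) := by rw [hrdef]; field_simp
  have hδ : (N : ℝ) / 2 * (1 / r - 1 / q) = δ := by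
    rw [hNr, hδdef, hγdef]
    field_simp
  have hγd : (N : ℝ) / 2 * (1 / (q / p) - 1 / q) = γ := by
    rw [hNr, hγdef]
    field_simp
  obtain ⟨K, hKtop, hK⟩ := exists_lintegral_mittagDensity_mul_rpow_le ⟨hδ0, hδ1⟩
  set D : ℝ := 2 * (1 / (1 - δ * p) + 1 / (1 - γ)) with hD
  have hD0 : 0 < D := by
    have h1 : 0 < 1 - δ * p := by linarith
    have h2 : 0 < 1 - γ := by linarith
    positivity
  -- Chosen so that the nonlinear contribution `5 D M^p` is `M/2`; `ε` below leaves the other half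
  -- for the linear part, with `+ 1` avoiding a zero denominator.
  set M : ℝ := (1 / (10 * D)) ^ (1 / (p - 1)) with hM
  have hM0 : 0 < M := by positivity
  have hMp : D * (5 * M ^ p) = M / 2 := by
    have h1 : M ^ p = M ^ (p - 1) * M := by
      rw [← Real.rpow_add_one hM0.ne', sub_add_cancel]
    have h2 : M ^ (p - 1) = 1 / (10 * D) := by
      rw [hM, ← Real.rpow_mul (by positivity), one_div_mul_cancel hpm.ne', Real.rpow_one]
    rw [h1, h2]
    field_simp
    norm_num
  set ε : ℝ := M / (2 * (K.toReal + 1)) with hε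
  have hKt : 0 ≤ K.toReal := ENNReal.toReal_nonneg
  have hε0 : 0 < ε := by positivity
  refine ⟨ε, hε0, fun α hα f hf hfε => ?_⟩
  have hsum : K * ENNReal.ofReal ε + ENNReal.ofReal D * (5 * ENNReal.ofReal M ^ p) ≤
      ENNReal.ofReal M := by
    rw [← ENNReal.ofReal_toReal hKtop.ne, show (5 : ℝ≥0∞) = ENNReal.ofReal 5 by norm_num,
      ENNReal.ofReal_rpow_of_pos hM0, ← ENNReal.ofReal_mul hKt, ← ENNReal.ofReal_mul (by norm_num),
      ← ENNReal.ofReal_mul hD0.le, hMp, ← ENNReal.ofReal_add (by positivity) (by positivity)]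
    refine ENNReal.ofReal_le_ofReal ?_
    have : K.toReal * ε ≤ M / 2 := by
      rw [hε, ← mul_div_assoc, div_le_div_iff₀ (by positivity) two_pos]
      nlinarith
    linarith
  have hbound : ∀ n t, 0 < t → ∫⁻ x, picard α p (volume.withDensity f) n t x ^ q ≤
      (ENNReal.ofReal M * ENNReal.ofReal (t ^ (-(α * δ)))) ^ q := by
    intro n
    induction n with
    | zero =>
      intro t _
      simp [picard, ENNReal.zero_rpow_of_pos hq0]
    | succ n ih =>
      intro t ht
      refine (lintegral_duhamel_rpow_le hα hp1 hr.le hrq.le hpq.le ⟨hγ0.le, hγ1⟩ hδ0 hδp hrel hδ hγd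
        (hK α hα) hf hfε (measurable_picard α p _ n) ih ht).trans ?_
      exact ENNReal.rpow_le_rpow (mul_le_mul_left hsum _) hq0.le
  rw [hasGlobalSolution_iff (by linarith)]
  intro T _
  refine ae_picardLimit_lt_top hq0 (by linarith) (fun t _ => ?_) hbound T
  exact ENNReal.rpow_lt_top_of_nonneg hq0.le
    (ENNReal.mul_lt_top ENNReal.ofReal_lt_top ENNReal.ofReal_lt_top).ne

/-! ### Lower bounds in a ball and nonexistence -/

/-- A lower bound, depending on the dimension only, of `P_α(t) χ_{B(0,r)}` in `B(0,r)` for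
`t^α ≤ r²`. -/
noncomputable def ballBound (N : ℕ) : ℝ := 2 / 3 * Real.exp (-2) * ballHeatBound N

lemma ballBound_pos (N : ℕ) : 0 < ballBound N :=
  mul_pos (mul_pos (by norm_num) (Real.exp_pos _)) (ballHeatBound_pos N)

lemma measurable_heat_mul_left (s : ℝ) (μ : Measure (Space N)) [SFinite μ] (x : Space N) :
    Measurable fun θ : ℝ => heat (s * θ) μ x :=
  (measurable_heat μ).comp (f := fun θ : ℝ => (s * θ, x)) (by fun_prop)

lemma le_heat_of_mem_Icc (hN : 1 ≤ N) {α t r θ : ℝ} (ht : 0 < t) (hr : 0 < r)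
    (htr : t ^ α ≤ r ^ 2) (hθ : θ ∈ Icc (1 / 2 : ℝ) 4) {x : Space N}
    (hx : x ∈ Metric.ball (0 : Space N) r) {f : Space N → ℝ≥0∞} (hf : Measurable f) {a : ℝ≥0∞}
    (ha : ∀ y ∈ Metric.ball (0 : Space N) r, a ≤ f y) :
    ENNReal.ofReal (ballHeatBound N) * a ≤ heat (t ^ α * θ) (volume.withDensity f) x := by
  have hta : 0 < t ^ α := Real.rpow_pos_of_pos ht α
  have hθ0 : 0 < θ := by linarith [hθ.1]
  refine heat_ball_lower_bound hN hr (mul_pos hta hθ0) ?_ hx hf ha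
  calc t ^ α * θ ≤ r ^ 2 * 4 := mul_le_mul htr hθ.2 hθ0.le (by positivity)
    _ = 4 * r ^ 2 := by ring

lemma le_opP_of_ball (hN : 1 ≤ N) {α t r : ℝ} (hα : α ∈ Ioo (0 : ℝ) 1) (ht : 0 < t) (hr : 0 < r)
    (htr : t ^ α ≤ r ^ 2) {x : Space N} (hx : x ∈ Metric.ball (0 : Space N) r)
    {f : Space N → ℝ≥0∞} (hf : Measurable f) {a : ℝ≥0∞}
    (ha : ∀ y ∈ Metric.ball (0 : Space N) r, a ≤ f y) :
    ENNReal.ofReal (ballBound N) * a ≤ opP α t (volume.withDensity f) x := by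
  have h := le_lintegral_mittagDensity_mul hα
    (measurable_heat_mul_left (t ^ α) (volume.withDensity f) x)
    (fun θ hθ => le_heat_of_mem_Icc hN ht hr htr hθ hx hf ha)
  rwa [← mul_assoc, ← ENNReal.ofReal_mul (by positivity)] at h

lemma le_opS_of_ball (hN : 1 ≤ N) {α t r : ℝ} (hα : α ∈ Ioo (0 : ℝ) 1) (ht : 0 < t) (hr : 0 < r)
    (htr : t ^ α ≤ r ^ 2) {x : Space N} (hx : x ∈ Metric.ball (0 : Space N) r)
    {f : Space N → ℝ≥0∞} (hf : Measurable f) {a : ℝ≥0∞}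
    (ha : ∀ y ∈ Metric.ball (0 : Space N) r, a ≤ f y) :
    ENNReal.ofReal (ballBound N / 2) * a ≤ opS α t (volume.withDensity f) x := by
  have h := le_lintegral_mittagDensity_mul hα
    (g := fun θ => ENNReal.ofReal θ * heat (t ^ α * θ) (volume.withDensity f) x)
    (m := ENNReal.ofReal (1 / 2) * (ENNReal.ofReal (ballHeatBound N) * a))
    (ENNReal.measurable_ofReal.mul (measurable_heat_mul_left _ _ _))
    (fun θ hθ => mul_le_mul' (ENNReal.ofReal_le_ofReal hθ.1)
      (le_heat_of_mem_Icc hN ht hr htr hθ hx hf ha))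
  rw [← mul_assoc, ← mul_assoc, ← ENNReal.ofReal_mul (by positivity),
    ← ENNReal.ofReal_mul (by positivity)] at h
  have e1 : 2 / 3 * Real.exp (-2) * (1 / 2) * ballHeatBound N = ballBound N / 2 := by
    unfold ballBound; ring
  rw [e1] at h
  refine h.trans_eq (lintegral_congr fun θ => ?_)
  ring

lemma ofReal_mul_lintegral_sub_rpow {α a t : ℝ} (hα : 0 < α) (hat : a ≤ t) :
    ENNReal.ofReal α * ∫⁻ s in Ioo a t, ENNReal.ofReal ((t - s) ^ (α - 1)) =
      ENNReal.ofReal ((t - a) ^ α) := by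
  rw [lintegral_sub_rpow hat (by linarith), sub_add_cancel, ← ENNReal.ofReal_mul hα.le]
  congr 1
  field_simp

/-- One feedback step: only the source on `(t₀,t)` is kept, and `α ∫ (t-s)^(α-1) ds = (t-t₀)^α` over
that interval. -/
lemma le_duhamel_of_ball (hN : 1 ≤ N) {α p T r t₀ t : ℝ} (hα : α ∈ Ioo (0 : ℝ) 1) (hp : 0 ≤ p)
    (hr : 0 < r) (hTr : T ^ α ≤ r ^ 2) (ht₀ : 0 ≤ t₀) (ht : t ∈ Ioc t₀ T)
    {x : Space N} (hx : x ∈ Metric.ball (0 : Space N) r) (μ : Measure (Space N))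
    {u : ℝ → Space N → ℝ≥0∞} (hu : Measurable (Function.uncurry u)) {a : ℝ≥0∞}
    (ha : ∀ s ∈ Ioc t₀ T, ∀ y ∈ Metric.ball (0 : Space N) r, a ≤ u s y) :
    ENNReal.ofReal ((t - t₀) ^ α) * (ENNReal.ofReal (ballBound N / 2) * a ^ p) ≤
      duhamel α p μ u t x := by
  have hup : Measurable (Function.uncurry fun (s : ℝ) (y : Space N) => u s y ^ p) :=
    hu.pow_const p
  calc _ = ENNReal.ofReal α * ∫⁻ s in Ioo t₀ t, ENNReal.ofReal ((t - s) ^ (α - 1)) *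
          (ENNReal.ofReal (ballBound N / 2) * a ^ p) := by
        rw [lintegral_mul_const _ (by fun_prop), ← mul_assoc (ENNReal.ofReal α),
          ofReal_mul_lintegral_sub_rpow hα.1 ht.1.le]
    _ ≤ ENNReal.ofReal α * ∫⁻ s in Ioo t₀ t, ENNReal.ofReal ((t - s) ^ (α - 1)) *
          opS α (t - s) (volume.withDensity fun y => u s y ^ p) x := by
        refine mul_le_mul_right (setLIntegral_mono' measurableSet_Ioo fun s hs => ?_) _
        refine mul_le_mul_right ?_ _
        refine le_opS_of_ball hN hα (sub_pos.2 hs.2) hr (le_trans ?_ hTr) hx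
          (hup.comp measurable_prodMk_left) fun y hy => ?_
        · exact Real.rpow_le_rpow (sub_nonneg.2 hs.2.le) (by linarith [hs.1, ht.2]) hα.1.le
        · exact ENNReal.rpow_le_rpow (ha s ⟨hs.1, hs.2.le.trans ht.2⟩ y hy) hp
    _ ≤ ENNReal.ofReal α * ∫⁻ s in Ioo 0 t, ENNReal.ofReal ((t - s) ^ (α - 1)) *
          opS α (t - s) (volume.withDensity fun y => u s y ^ p) x :=
        mul_le_mul_right (lintegral_mono_set (Ioo_subset_Ioo_left ht₀)) _
    _ ≤ _ := le_add_self

/-- The constant in the necessary condition for solvability. -/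
noncomputable def blowupConst (N : ℕ) (p : ℝ) : ℝ :=
  8 * 2 ^ (1 / (p - 1)) / ballBound N ^ p

lemma blowupConst_pos (N : ℕ) (p : ℝ) : 0 < blowupConst N p := by
  have := ballBound_pos N
  unfold blowupConst
  positivity

/-- The power `p` turns the factor `2^(n/(p-1))` into itself times `2^n`, which compensates the
shrinking `2^(-(n+2))` of the time gap. The `8` in `h` is this remaining `4` times the `2` in `c /
2`. -/
lemma growth_step {c A p τ d : ℝ} (hc : 0 < c) (hA : 0 < A) (hp : 1 < p)
    (h : 8 * 2 ^ (1 / (p - 1)) / c ^ p < τ * A ^ (p - 1)) (n : ℕ)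
    (hd : τ * (1 / 2) ^ (n + 2) ≤ d) :
    c * A * 2 ^ (((n + 1 : ℕ) : ℝ) / (p - 1)) ≤
      d * (c / 2 * (c * A * 2 ^ ((n : ℝ) / (p - 1))) ^ p) := by
  have hpm : 0 < p - 1 := by linarith
  have e1 : (2 : ℝ) ^ (((n + 1 : ℕ) : ℝ) / (p - 1)) = 2 ^ ((n : ℝ) / (p - 1)) * 2 ^ (1 / (p - 1)) := by
    rw [← Real.rpow_add two_pos]
    congr 1
    push_cast
    ring
  have e2 : ((2 : ℝ) ^ ((n : ℝ) / (p - 1))) ^ p = 2 ^ ((n : ℝ) / (p - 1)) * 2 ^ n := by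
    rw [← Real.rpow_mul zero_le_two, ← Real.rpow_natCast, ← Real.rpow_add two_pos]
    congr 1
    field_simp
    ring
  have e3 : A ^ p = A ^ (p - 1) * A := by rw [← Real.rpow_add_one hA.ne', sub_add_cancel]
  have hcp : 0 < c ^ p := Real.rpow_pos_of_pos hc p
  rw [div_lt_iff₀ hcp] at h
  have hX : (0 : ℝ) < 2 ^ ((n : ℝ) / (p - 1)) := by positivity
  have h2 : (1 / 2 : ℝ) ^ (n + 2) * 2 ^ n = 1 / 4 := by
    rw [pow_add, mul_right_comm, ← mul_pow]
    norm_num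
  refine le_trans ?_ (mul_le_mul_of_nonneg_right hd (by positivity))
  rw [Real.mul_rpow (by positivity) hX.le, Real.mul_rpow hc.le hA.le, e1, e2, e3]
  calc c * A * (2 ^ ((n : ℝ) / (p - 1)) * 2 ^ (1 / (p - 1)))
      = c * A * 2 ^ ((n : ℝ) / (p - 1)) / 8 * (8 * 2 ^ (1 / (p - 1))) := by ring
    _ ≤ c * A * 2 ^ ((n : ℝ) / (p - 1)) / 8 * (τ * A ^ (p - 1) * c ^ p) :=
        mul_le_mul_of_nonneg_left h.le (by positivity)
    _ = τ * (1 / 4) * (c / 2 * (c ^ p * (A ^ (p - 1) * A) * 2 ^ ((n : ℝ) / (p - 1)))) := by ring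
    _ = _ := by rw [← h2]; ring

/-- Lower bounds of the solution growing geometrically on shrinking time intervals. -/
lemma le_picardLimit_of_ball (hN : 1 ≤ N) {α p T r A : ℝ} (hα : α ∈ Ioo (0 : ℝ) 1) (hp : 1 < p)
    (hr : 0 < r) (hT : 0 < T) (hTr : T ^ α ≤ r ^ 2) (hA : 0 < A) {f : Space N → ℝ≥0∞}
    (hf : Measurable f) (hfA : ∀ y ∈ Metric.ball (0 : Space N) r, ENNReal.ofReal A ≤ f y)
    (hbig : blowupConst N p < T ^ α * A ^ (p - 1)) (n : ℕ) :
    ∀ t ∈ Ioc (T / 2 * (1 - (1 / 2) ^ n)) T, ∀ x ∈ Metric.ball (0 : Space N) r,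
      ENNReal.ofReal (ballBound N * A * 2 ^ ((n : ℝ) / (p - 1))) ≤
        picardLimit α p (volume.withDensity f) t x := by
  have hc := ballBound_pos N
  have hp0 : 0 < p := by linarith
  induction n with
  | zero =>
    intro t ht x hx
    -- The base case uses the linear term `P_α(t) f` alone.
    have ht0 : 0 < t := by simpa using ht.1
    rw [← duhamel_picardLimit α hp0 _ t x]
    refine le_trans ?_ le_self_add
    have := le_opP_of_ball hN hα ht0 hr
      ((Real.rpow_le_rpow ht0.le ht.2 hα.1.le).trans hTr) hx hf hfA
    rw [← ENNReal.ofReal_mul hc.le] at this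
    simpa using this
  | succ n ih =>
    intro t ht x hx
    have hpow : (1 / 2 : ℝ) ^ n ≤ 1 := pow_le_one₀ (by norm_num) (by norm_num)
    have ht₀ : 0 ≤ T / 2 * (1 - (1 / 2) ^ n) := mul_nonneg (by linarith) (by linarith)
    have hgap : T * (1 / 2) ^ (n + 2) ≤ t - T / 2 * (1 - (1 / 2) ^ n) := by
      have := ht.1
      have e : T / 2 * (1 - (1 / 2) ^ (n + 1)) - T / 2 * (1 - (1 / 2) ^ n) =
          T * (1 / 2) ^ (n + 2) := by ring
      linarith
    -- As `α < 1`, raising the fraction `2^(-(n+2)) ≤ 1` to the power `α` only increases it; this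
    -- keeps the blow-up constant free of `α`.
    have hd : T ^ α * (1 / 2) ^ (n + 2) ≤ (t - T / 2 * (1 - (1 / 2) ^ n)) ^ α := by
      refine le_trans ?_ (Real.rpow_le_rpow (by positivity) hgap hα.1.le)
      rw [Real.mul_rpow hT.le (by positivity)]
      refine mul_le_mul_of_nonneg_left ?_ (by positivity)
      simpa using Real.rpow_le_rpow_of_exponent_ge (by positivity : (0 : ℝ) < (1 / 2) ^ (n + 2))
        (pow_le_one₀ (by norm_num) (by norm_num)) hα.2.le
    have ht' : t ∈ Ioc (T / 2 * (1 - (1 / 2) ^ n)) T := by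
      refine ⟨?_, ht.2⟩
      have : 0 < T * (1 / 2) ^ (n + 2) := by positivity
      linarith
    rw [← duhamel_picardLimit α hp0 _ t x]
    refine le_trans ?_ (le_duhamel_of_ball hN hα hp0.le hr hTr ht₀ ht' hx _
      (measurable_picardLimit α p _) ih)
    rw [ENNReal.ofReal_rpow_of_pos (by positivity), ← ENNReal.ofReal_mul (by positivity),
      ← ENNReal.ofReal_mul (Real.rpow_nonneg (sub_nonneg.2 ht'.1.le) _)]
    exact ENNReal.ofReal_le_ofReal (growth_step hc hA hp hbig n hd)

lemma slab_prod_ball_pos {T r : ℝ} (hT : 0 < T) (hr : 0 < r) :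
    0 < slab N T (Ioc (T / 2) T ×ˢ Metric.ball (0 : Space N) r) := by
  unfold slab
  rw [Measure.prod_prod, Measure.restrict_apply measurableSet_Ioc,
    inter_eq_left.2 (Ioc_subset_Ioc_left (by linarith)), Real.volume_Ioc]
  exact ENNReal.mul_pos (ENNReal.ofReal_pos.2 (by linarith)).ne'
    (Metric.measure_ball_pos _ _ hr).ne'

/-- All the shrinking intervals contain `(T/2, T]`, so otherwise every geometric lower bound holds
there at once and `picardLimit = ∞` on `(T/2, T] × B(0,r)`. -/
lemma rpow_mul_rpow_le_blowupConst (hN : 1 ≤ N) {α p T r A : ℝ} (hα : α ∈ Ioo (0 : ℝ) 1)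
    (hp : 1 < p) (hr : 0 < r) (hT : 0 < T) (hTr : T ^ α ≤ r ^ 2) (hA : 0 < A)
    {f : Space N → ℝ≥0∞} (hf : Measurable f)
    (hfA : ∀ y ∈ Metric.ball (0 : Space N) r, ENNReal.ofReal A ≤ f y)
    (hfin : ∀ᵐ z ∂(slab N T), picardLimit α p (volume.withDensity f) z.1 z.2 < ∞) :
    T ^ α * A ^ (p - 1) ≤ blowupConst N p := by
  by_contra! hbig
  have hpm : 0 < p - 1 := by linarith
  have hc := ballBound_pos N
  have htop : ∀ z ∈ Ioc (T / 2) T ×ˢ Metric.ball (0 : Space N) r,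
      ¬ picardLimit α p (volume.withDensity f) z.1 z.2 < ∞ := by
    rintro ⟨t, x⟩ ⟨ht, hx⟩
    have htend : Tendsto (fun n : ℕ => ENNReal.ofReal (ballBound N * A * 2 ^ ((n : ℝ) / (p - 1))))
        atTop (𝓝 ∞) := by
      refine ENNReal.tendsto_ofReal_atTop.comp ?_
      refine Tendsto.const_mul_atTop (mul_pos hc hA) ?_
      exact (tendsto_rpow_atTop_of_base_gt_one 2 one_lt_two).comp
        (tendsto_natCast_atTop_atTop.atTop_div_const hpm)
    rw [not_lt]
    refine le_of_tendsto' htend fun n => ?_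
    refine le_picardLimit_of_ball hN hα hp hr hT hTr hA hf hfA hbig n t ⟨?_, ht.2⟩ x hx
    have : (0 : ℝ) < (1 / 2) ^ n := by positivity
    have h1 : T / 2 < t := ht.1
    nlinarith
  exact (slab_prod_ball_pos hT hr).ne' (measure_mono_null htop hfin)

/-- A necessary condition for solvability up to time `T`. -/
lemma min_mul_rpow_le_blowupConst (hN : 1 ≤ N) {α p T r A : ℝ} (hα : α ∈ Ioo (0 : ℝ) 1)
    (hp : 1 < p) (hr : 0 < r) (hT : 0 < T) (hA : 0 < A) {f : Space N → ℝ≥0∞} (hf : Measurable f)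
    (hfA : ∀ y ∈ Metric.ball (0 : Space N) r, ENNReal.ofReal A ≤ f y)
    (hfin : ∀ᵐ z ∂(slab N T), picardLimit α p (volume.withDensity f) z.1 z.2 < ∞) :
    min (T ^ α) (r ^ 2) * A ^ (p - 1) ≤ blowupConst N p := by
  rcases le_total (T ^ α) (r ^ 2) with h | h
  · rw [min_eq_left h]
    exact rpow_mul_rpow_le_blowupConst hN hα hp hr hT h hA hf hfA hfin
  · rw [min_eq_right h]
    have hpow : ((r ^ 2) ^ (1 / α)) ^ α = r ^ 2 := by
      rw [← Real.rpow_mul (by positivity), one_div_mul_cancel hα.1.ne', Real.rpow_one]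
    -- When `T^α` exceeds `r²`, restrict to the shorter time `r^(2/α)`, at which the two agree.
    have hle : (r ^ 2) ^ (1 / α) ≤ T := by
      rw [← Real.rpow_le_rpow_iff (by positivity) hT.le hα.1, hpow]
      exact h
    have := rpow_mul_rpow_le_blowupConst hN hα hp hr
      (T := (r ^ 2) ^ (1 / α)) (by positivity) hpow.le hA hf hfA
      (ae_mono (slab_mono hle) hfin)
    rwa [hpow] at this

/-! ### Local existence for bounded data -/

lemma opP_le_of_le {α t : ℝ} (hα : α ∈ Ioo (0 : ℝ) 1) (ht : 0 < t) {f : Space N → ℝ≥0∞}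
    (hf : Measurable f) {a : ℝ≥0∞} (h : ∀ y, f y ≤ a) (x : Space N) :
    opP α t (volume.withDensity f) x ≤ a := by
  calc _ ≤ ∫⁻ θ in Ioi 0, mittagDensity α θ * a :=
        setLIntegral_mono' measurableSet_Ioi fun θ hθ => mul_le_mul_right
          (heat_le_of_le (mul_pos (Real.rpow_pos_of_pos ht α) hθ) hf h x) _
    _ = a := by
        rw [lintegral_mul_const _ (measurable_mittagDensity α), lintegral_mittagDensity hα, one_mul]

lemma opS_le_of_le {α t : ℝ} (hα : α ∈ Ioo (0 : ℝ) 1) (ht : 0 < t) {f : Space N → ℝ≥0∞}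
    (hf : Measurable f) {a : ℝ≥0∞} (h : ∀ y, f y ≤ a) (x : Space N) :
    opS α t (volume.withDensity f) x ≤ 4 * a := by
  calc _ ≤ ∫⁻ θ in Ioi 0, ENNReal.ofReal θ * mittagDensity α θ * a :=
        setLIntegral_mono' measurableSet_Ioi fun θ hθ => mul_le_mul_right
          (heat_le_of_le (mul_pos (Real.rpow_pos_of_pos ht α) hθ) hf h x) _
    _ ≤ 4 * a := by
        have hm := measurable_mittagDensity α
        rw [lintegral_mul_const _ (by fun_prop)]
        exact mul_le_mul_left (lintegral_mul_mittagDensity_le hα) _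

/-- Bounded data: the iterates stay below `2A` up to a time comparable to `A^{-(p-1)/α}`. -/
lemma picard_le_of_bounded {α p T A : ℝ} (hα : α ∈ Ioo (0 : ℝ) 1) (hp : 0 < p) (hA : 0 < A)
    (hTA : T ^ α * (4 * (2 * A) ^ p) ≤ A) {f : Space N → ℝ≥0∞} (hf : Measurable f)
    (hfA : ∀ y, f y ≤ ENNReal.ofReal A) (n : ℕ) :
    ∀ t ∈ Ioc 0 T, ∀ x, picard α p (volume.withDensity f) n t x ≤ ENNReal.ofReal (2 * A) := by
  induction n with
  | zero => exact fun _ _ _ => zero_le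
  | succ n ih =>
    intro t ht x
    have hup : Measurable (Function.uncurry fun (s : ℝ) (y : Space N) =>
        picard α p (volume.withDensity f) n s y ^ p) :=
      (measurable_picard α p _ n).pow_const p
    calc duhamel α p (volume.withDensity f) (picard α p (volume.withDensity f) n) t x
        ≤ ENNReal.ofReal A + ENNReal.ofReal α * ∫⁻ s in Ioo 0 t,
            ENNReal.ofReal ((t - s) ^ (α - 1)) * (4 * ENNReal.ofReal (2 * A) ^ p) := by
          refine add_le_add (opP_le_of_le hα ht.1 hf hfA x)
            (mul_le_mul_right (setLIntegral_mono' measurableSet_Ioo fun s hs => ?_) _)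
          refine mul_le_mul_right (opS_le_of_le hα (sub_pos.2 hs.2)
            (hup.comp measurable_prodMk_left) (fun y => ?_) x) _
          exact ENNReal.rpow_le_rpow (ih s ⟨hs.1, hs.2.le.trans ht.2⟩ y) hp.le
      _ = ENNReal.ofReal A + ENNReal.ofReal (t ^ α * (4 * (2 * A) ^ p)) := by
          rw [lintegral_mul_const _ (by fun_prop), ← mul_assoc,
            ofReal_mul_lintegral_sub_rpow hα.1 ht.1.le, sub_zero,
            ENNReal.ofReal_rpow_of_pos (by positivity),
            show (4 : ℝ≥0∞) = ENNReal.ofReal 4 by norm_num, ← ENNReal.ofReal_mul (by norm_num),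
            ← ENNReal.ofReal_mul (Real.rpow_nonneg ht.1.le _)]
      _ ≤ ENNReal.ofReal (2 * A) := by
          have : t ^ α * (4 * (2 * A) ^ p) ≤ A :=
            (mul_le_mul_of_nonneg_right (Real.rpow_le_rpow ht.1.le ht.2 hα.1.le)
              (by positivity)).trans hTA
          rw [← ENNReal.ofReal_add hA.le (mul_nonneg (Real.rpow_nonneg ht.1.le _) (by positivity))]
          exact ENNReal.ofReal_le_ofReal (by linarith)

lemma ofReal_le_lifespan_of_bounded {α p T A : ℝ} (hα : α ∈ Ioo (0 : ℝ) 1) (hp : 0 < p)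
    (hA : 0 < A) (hT : 0 < T) (hTA : T ^ α * (4 * (2 * A) ^ p) ≤ A) {f : Space N → ℝ≥0∞}
    (hf : Measurable f) (hfA : ∀ y, f y ≤ ENNReal.ofReal A) :
    ENNReal.ofReal T ≤ lifespan α p (volume.withDensity f) := by
  refine ofReal_le_lifespan hp hT ?_
  filter_upwards [ae_mem_Ioc_slab T] with z hz
  exact (iSup_le fun n => picard_le_of_bounded hα hp hA hTA hf hfA n z.1 hz z.2).trans_lt
    ENNReal.ofReal_lt_top

/-! ### The data `κ ψ_j`: threshold and life span bounds -/

lemma one_lt_and_lt_sub_one_of_fujitaExponent_lt (hN : 1 ≤ N) {p : ℝ} (hp : fujitaExponent N < p) :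
    1 < p ∧ 2 / (N : ℝ) < p - 1 := by
  have hN0 : (0 : ℝ) < N := by exact_mod_cast hN
  have hp' : 1 + 2 / (N : ℝ) < p := hp
  have := div_pos two_pos hN0
  constructor <;> linarith

lemma radius_pos {j : ℕ} (hj : 1 ≤ j) : 0 < radius N j := by
  have := unitBallVolume_pos N
  have hj0 : (0 : ℝ) < j := by exact_mod_cast hj
  unfold radius
  positivity

lemma volume_ball_radius (hN : 1 ≤ N) {j : ℕ} (hj : 1 ≤ j) :
    volume (Metric.ball (0 : Space N) (radius N j)) = ENNReal.ofReal (j : ℝ)⁻¹ := by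
  have hN0 : (0 : ℝ) < N := by exact_mod_cast hN
  have hω := unitBallVolume_pos N
  have hj0 : (0 : ℝ) < j := by exact_mod_cast hj
  rw [volume_ball_eq hN _ (radius_pos hj).le]
  congr 1
  unfold radius
  rw [← Real.rpow_natCast, ← Real.rpow_mul (by positivity), neg_mul, one_div_mul_cancel hN0.ne',
    Real.rpow_neg_one]
  field_simp

/-- The density of the datum `κ ψ_j`. -/
noncomputable def datumDensity (N : ℕ) (κ : ℝ) (j : ℕ) (x : Space N) : ℝ≥0∞ :=
  ENNReal.ofReal (κ * psi N j x)

lemma datumDensity_eq (κ : ℝ) (j : ℕ) : datumDensity N κ j =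
    (Metric.ball (0 : Space N) (radius N j)).indicator fun _ => ENNReal.ofReal (κ * j) := by
  funext x
  unfold datumDensity psi
  by_cases hx : x ∈ Metric.ball (0 : Space N) (radius N j)
  · rw [indicator_of_mem hx, indicator_of_mem hx]
  · rw [indicator_of_notMem hx, indicator_of_notMem hx, mul_zero, ENNReal.ofReal_zero]

lemma measurable_datumDensity (κ : ℝ) (j : ℕ) : Measurable (datumDensity N κ j) := by
  rw [datumDensity_eq]
  exact measurable_const.indicator Metric.isOpen_ball.measurableSet

lemma datum_eq (κ : ℝ) (j : ℕ) : datum N κ j = volume.withDensity (datumDensity N κ j) := rfl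

lemma datumDensity_le (κ : ℝ) (j : ℕ) (x : Space N) :
    datumDensity N κ j x ≤ ENNReal.ofReal (κ * j) := by
  rw [datumDensity_eq]
  exact indicator_le_self _ _ x

lemma le_datumDensity (κ : ℝ) (j : ℕ) :
    ∀ x ∈ Metric.ball (0 : Space N) (radius N j), ENNReal.ofReal (κ * j) ≤ datumDensity N κ j x := by
  intro x hx
  rw [datumDensity_eq, indicator_of_mem hx]

lemma lintegral_datumDensity_rpow (hN : 1 ≤ N) {κ r : ℝ} (hr : 0 < r) {j : ℕ} (hj : 1 ≤ j) :
    ∫⁻ x, datumDensity N κ j x ^ r = ENNReal.ofReal (κ * j) ^ r * ENNReal.ofReal (j : ℝ)⁻¹ := by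
  have h : ∀ x, datumDensity N κ j x ^ r =
      (Metric.ball (0 : Space N) (radius N j)).indicator
        (fun _ => ENNReal.ofReal (κ * j) ^ r) x := by
    intro x
    rw [datumDensity_eq]
    by_cases hx : x ∈ Metric.ball (0 : Space N) (radius N j)
    · rw [indicator_of_mem hx, indicator_of_mem hx]
    · rw [indicator_of_notMem hx, indicator_of_notMem hx, ENNReal.zero_rpow_of_pos hr]
  simp_rw [h]
  rw [lintegral_indicator_const Metric.isOpen_ball.measurableSet, volume_ball_radius hN hj]

lemma datum_mono {κ κ' : ℝ} (h : κ ≤ κ') (j : ℕ) : datum N κ j ≤ datum N κ' j := by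
  refine withDensity_mono (ae_of_all _ fun x => ENNReal.ofReal_le_ofReal ?_)
  refine mul_le_mul_of_nonneg_right h ?_
  exact indicator_nonneg (fun _ _ => Nat.cast_nonneg j) x

/-- For this `κ` the norm of the datum in `L^(N(p-1)/2)` equals `ε` exactly, since the ball has
volume `1/j`. -/
lemma exists_hasGlobalSolution_datum (hN : 1 ≤ N) {p : ℝ} (hp : fujitaExponent N < p) :
    ∃ ε : ℝ, 0 < ε ∧ ∀ α ∈ Ioo (0 : ℝ) 1, ∀ j : ℕ, 1 ≤ j →
      HasGlobalSolution α p (datum N (ε * (j : ℝ) ^ (2 / ((N : ℝ) * (p - 1)) - 1)) j) := by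
  have hN0 : (0 : ℝ) < N := by exact_mod_cast hN
  have hpm : 0 < p - 1 := by linarith [(one_lt_and_lt_sub_one_of_fujitaExponent_lt hN hp).1]
  obtain ⟨ε, hε, h⟩ := exists_hasGlobalSolution_of_small hN hp
  refine ⟨ε, hε, fun α hα j hj => ?_⟩
  rw [datum_eq]
  refine h α hα _ (measurable_datumDensity _ j) ?_
  have hj0 : (0 : ℝ) < j := by exact_mod_cast hj
  have hr : 0 < (N : ℝ) * (p - 1) / 2 := by positivity
  rw [lintegral_datumDensity_rpow hN hr hj, ENNReal.ofReal_rpow_of_pos (by positivity),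
    ENNReal.ofReal_rpow_of_pos hε, ← ENNReal.ofReal_mul (by positivity)]
  refine ENNReal.ofReal_le_ofReal (le_of_eq ?_)
  have e1 : ε * (j : ℝ) ^ (2 / ((N : ℝ) * (p - 1)) - 1) * j =
      ε * (j : ℝ) ^ (2 / ((N : ℝ) * (p - 1))) := by
    rw [mul_assoc, ← Real.rpow_add_one hj0.ne', sub_add_cancel]
  rw [e1, Real.mul_rpow hε.le (by positivity), ← Real.rpow_mul hj0.le,
    show 2 / ((N : ℝ) * (p - 1)) * ((N : ℝ) * (p - 1) / 2) = 1 by field_simp, Real.rpow_one]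
  field_simp

lemma min_mul_rpow_le_of_datum (hN : 1 ≤ N) {α p T κ : ℝ} (hα : α ∈ Ioo (0 : ℝ) 1) (hp : 1 < p)
    (hT : 0 < T) (hκ : 0 < κ) {j : ℕ} (hj : 1 ≤ j)
    (hfin : ∀ᵐ z ∂(slab N T), picardLimit α p (datum N κ j) z.1 z.2 < ∞) :
    min (T ^ α) (radius N j ^ 2) * (κ * j) ^ (p - 1) ≤ blowupConst N p :=
  min_mul_rpow_le_blowupConst hN hα hp (radius_pos hj) hT
    (mul_pos hκ (by exact_mod_cast hj)) (measurable_datumDensity κ j) (le_datumDensity κ j) hfin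

/-- The necessary condition at time `T = r_j^(2/α)` reads `r_j² (κ j)^(p-1) ≤ C`; `α` has
disappeared, so the bound is uniform in it. -/
lemma le_of_hasGlobalSolution_datum (hN : 1 ≤ N) {α p κ : ℝ} (hα : α ∈ Ioo (0 : ℝ) 1)
    (hp : 1 < p) (hκ : 0 < κ) {j : ℕ} (hj : 1 ≤ j) (h : HasGlobalSolution α p (datum N κ j)) :
    κ ≤ (blowupConst N p * unitBallVolume N ^ (2 / (N : ℝ))) ^ (1 / (p - 1)) *
      (j : ℝ) ^ (2 / ((N : ℝ) * (p - 1)) - 1) := by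
  have hN0 : (0 : ℝ) < N := by exact_mod_cast hN
  have hj0 : (0 : ℝ) < j := by exact_mod_cast hj
  have hpm : 0 < p - 1 := by linarith
  have hω := unitBallVolume_pos N
  have hC := blowupConst_pos N p
  have hr := radius_pos (N := N) hj
  have hsol : SFinite (datum N κ j) := by rw [datum_eq]; infer_instance
  have hT : 0 < (radius N j ^ 2) ^ (1 / α) := by positivity
  have h1 := min_mul_rpow_le_of_datum hN hα hp hT hκ hj
    ((hasGlobalSolution_iff (by linarith)).1 h _ hT)
  rw [← Real.rpow_mul (by positivity), one_div_mul_cancel hα.1.ne', Real.rpow_one, min_self] at h1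
  have h2 : radius N j ^ 2 = ((j : ℝ) ^ (2 / (N : ℝ)) * unitBallVolume N ^ (2 / (N : ℝ)))⁻¹ := by
    unfold radius
    rw [← Real.mul_rpow hj0.le hω.le, ← Real.rpow_natCast, ← Real.rpow_mul (by positivity),
      ← Real.rpow_neg (by positivity)]
    congr 1
    push_cast
    ring
  rw [h2, inv_mul_le_iff₀ (by positivity)] at h1
  have h3 : κ * j ≤ ((j : ℝ) ^ (2 / (N : ℝ)) * unitBallVolume N ^ (2 / (N : ℝ)) *
      blowupConst N p) ^ (1 / (p - 1)) := by
    have := Real.rpow_le_rpow (by positivity) h1 (by positivity : 0 ≤ 1 / (p - 1))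
    rwa [← Real.rpow_mul (by positivity), mul_one_div_cancel hpm.ne', Real.rpow_one] at this
  rw [mul_assoc, Real.mul_rpow (by positivity) (by positivity), ← Real.rpow_mul hj0.le] at h3
  rw [Real.rpow_sub_one hj0.ne', ← mul_div_assoc, le_div_iff₀ hj0]
  refine h3.trans_eq ?_
  rw [mul_comm (unitBallVolume N ^ _), mul_comm]
  congr 2
  field_simp

/-- The life span is short once `κ j` is large compared with the radius. -/
lemma lifespan_le_of_lt (hN : 1 ≤ N) {α p κ : ℝ} (hα : α ∈ Ioo (0 : ℝ) 1) (hp : 1 < p)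
    (hκ : 0 < κ) {j : ℕ} (hj : 1 ≤ j)
    (h : blowupConst N p * (κ * j) ^ (-(p - 1)) < radius N j ^ 2) :
    lifespan α p (datum N κ j) ≤
      ENNReal.ofReal (blowupConst N p ^ (1 / α) * (κ * j) ^ (-((p - 1) / α))) := by
  have hj0 : (0 : ℝ) < j := by exact_mod_cast hj
  have hA : 0 < κ * j := mul_pos hκ hj0
  have hC := blowupConst_pos N p
  have hα0 := hα.1
  have hX : blowupConst N p ^ (1 / α) * (κ * j) ^ (-((p - 1) / α)) =
      (blowupConst N p * (κ * j) ^ (-(p - 1))) ^ (1 / α) := by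
    rw [Real.mul_rpow hC.le (by positivity), ← Real.rpow_mul hA.le]
    congr 2
    ring
  rw [hX]
  by_contra! hlt
  obtain ⟨T, hT, hTlt, hfin⟩ := exists_of_lt_lifespan (by linarith) hlt
  have h1 := min_mul_rpow_le_of_datum hN hα hp hT hκ hj hfin
  rw [ENNReal.ofReal_lt_ofReal_iff hT] at hTlt
  have h2 := Real.rpow_lt_rpow (by positivity) hTlt hα0
  rw [← Real.rpow_mul (by positivity), one_div_mul_cancel hα0.ne', Real.rpow_one] at h2
  have h3 := lt_min h2 h
  rw [Real.rpow_neg hA.le, ← div_eq_mul_inv, div_lt_iff₀ (by positivity)] at h3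
  exact absurd h1 (not_le.2 h3)

/-- Either `r_j` is already below the right-hand side, or it is larger and `lifespan_le_of_lt`
applies. -/
lemma min_lifespan_radius_le (hN : 1 ≤ N) {α p κ : ℝ} (hα : α ∈ Ioo (0 : ℝ) 1) (hp : 1 < p)
    (hκ : 0 < κ) {j : ℕ} (hj : 1 ≤ j) :
    min (lifespan α p (datum N κ j) ^ (α / 2)) (ENNReal.ofReal (radius N j)) ≤
      ENNReal.ofReal (Real.sqrt (blowupConst N p) * (κ * j) ^ (-((p - 1) / 2))) := by
  have hj0 : (0 : ℝ) < j := by exact_mod_cast hj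
  have hA : 0 < κ * j := mul_pos hκ hj0
  have hC := blowupConst_pos N p
  have hα0 := hα.1
  have hsq : (Real.sqrt (blowupConst N p) * (κ * j) ^ (-((p - 1) / 2))) ^ 2 =
      blowupConst N p * (κ * j) ^ (-(p - 1)) := by
    rw [mul_pow, Real.sq_sqrt hC.le, ← Real.rpow_natCast ((κ * j) ^ _), ← Real.rpow_mul hA.le]
    congr 2
    push_cast
    ring
  rcases lt_or_ge (blowupConst N p * (κ * j) ^ (-(p - 1))) (radius N j ^ 2) with h | h
  · refine (min_le_left _ _).trans ?_
    refine (ENNReal.rpow_le_rpow (lifespan_le_of_lt hN hα hp hκ hj h)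
      (by positivity)).trans_eq ?_
    rw [ENNReal.ofReal_rpow_of_pos (by positivity), Real.mul_rpow (by positivity) (by positivity),
      ← Real.rpow_mul hC.le, ← Real.rpow_mul hA.le, Real.sqrt_eq_rpow]
    congr 3 <;> field_simp
  · refine (min_le_right _ _).trans (ENNReal.ofReal_le_ofReal ?_)
    rw [← hsq] at h
    exact (pow_le_pow_iff_left₀ (radius_pos hj).le (by positivity) two_ne_zero).1 h

/-- The left side decays like `j^(-(p-1))` and `r_j²` like `j^(-2/N)`; `p > p_F` makes the former
faster. -/
lemma eventually_lt_radius_sq (hN : 1 ≤ N) {p κ : ℝ} (hp : fujitaExponent N < p) (hκ : 0 < κ) :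
    ∀ᶠ j : ℕ in atTop, blowupConst N p * (κ * j) ^ (-(p - 1)) < radius N j ^ 2 := by
  have hN0 : (0 : ℝ) < N := by exact_mod_cast hN
  have hω := unitBallVolume_pos N
  obtain ⟨hp1, hpN⟩ := one_lt_and_lt_sub_one_of_fujitaExponent_lt hN hp
  have hlim : Tendsto (fun j : ℕ => blowupConst N p * κ ^ (-(p - 1)) *
      (j : ℝ) ^ (-(p - 1 - 2 / (N : ℝ)))) atTop (𝓝 0) := by
    have := ((tendsto_rpow_neg_atTop (sub_pos.2 hpN)).comp
      tendsto_natCast_atTop_atTop).const_mul (blowupConst N p * κ ^ (-(p - 1)))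
    simpa using this
  have hpos : 0 < unitBallVolume N ^ (-(2 / (N : ℝ))) := by positivity
  filter_upwards [hlim.eventually_lt_const hpos, eventually_ge_atTop 1] with j hj hj1
  have hj0 : (0 : ℝ) < j := by exact_mod_cast hj1
  have h2 : radius N j ^ 2 = (j : ℝ) ^ (-(2 / (N : ℝ))) * unitBallVolume N ^ (-(2 / (N : ℝ))) := by
    unfold radius
    rw [← Real.mul_rpow hj0.le hω.le, ← Real.rpow_natCast, ← Real.rpow_mul (by positivity)]
    congr 1
    push_cast
    ring
  rw [h2, Real.mul_rpow hκ.le hj0.le]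
  have h3 := mul_lt_mul_of_pos_left hj (Real.rpow_pos_of_pos hj0 (-(2 / (N : ℝ))))
  refine lt_of_eq_of_lt ?_ h3
  have e : (j : ℝ) ^ (-(p - 1)) =
      (j : ℝ) ^ (-(2 / (N : ℝ))) * (j : ℝ) ^ (-(p - 1 - 2 / (N : ℝ))) := by
    rw [← Real.rpow_add hj0]
    congr 1
    ring
  rw [e]
  ring

/-- The time is the solution of `T^α · 4 (2A)^p = A` with `A = κ j`, the limit case of
`ofReal_le_lifespan_of_bounded`. -/
lemma le_lifespan_datum {α p κ : ℝ} (hα : α ∈ Ioo (0 : ℝ) 1) (hp : 0 < p)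
    (hκ : 0 < κ) {j : ℕ} (hj : 1 ≤ j) :
    ENNReal.ofReal (((4 * 2 ^ p : ℝ)⁻¹) ^ (1 / α) * (κ * j) ^ (-((p - 1) / α))) ≤
      lifespan α p (datum N κ j) := by
  have hA : 0 < κ * j := mul_pos hκ (by exact_mod_cast hj)
  have hα0 := hα.1
  refine ofReal_le_lifespan_of_bounded hα hp hA (by positivity) (le_of_eq ?_)
    (measurable_datumDensity κ j) (datumDensity_le κ j)
  rw [Real.mul_rpow (by positivity) (by positivity), ← Real.rpow_mul (by positivity),
    ← Real.rpow_mul hA.le, one_div_mul_cancel hα0.ne', Real.rpow_one, neg_mul,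
    div_mul_cancel₀ _ hα0.ne', Real.mul_rpow zero_le_two hA.le, neg_sub, Real.rpow_sub hA,
    Real.rpow_one]
  have : 0 < (κ * j) ^ p := by positivity
  field_simp

/-! ### Assembly of the two-sided estimates -/

/-- The threshold between global existence and nonexistence for the data `κ ψ_j`. -/
noncomputable def globalThreshold (N : ℕ) (p α : ℝ) (j : ℕ) : ℝ :=
  sSup {κ : ℝ | 0 < κ ∧ HasGlobalSolution α p (datum N κ j)}

lemma limsup_ofReal_mem_Ioo {c : ℝ} (hc : 0 < c) {f : ℝ → ℝ}
    (hf : Tendsto f (𝓝[<] (1 : ℝ)) (𝓝 c)) :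
    limsup (fun α => ENNReal.ofReal (f α)) (𝓝[<] (1 : ℝ)) ∈ Ioo (0 : ℝ≥0∞) ∞ := by
  have h : Tendsto (fun α => ENNReal.ofReal (f α)) (𝓝[<] (1 : ℝ)) (𝓝 (ENNReal.ofReal c)) :=
    (ENNReal.continuous_ofReal.tendsto c).comp hf
  rw [h.limsup_eq]
  exact ⟨ENNReal.ofReal_pos.2 hc, ENNReal.ofReal_lt_top⟩

lemma tendsto_rpow_one_div {c : ℝ} (hc : 0 < c) :
    Tendsto (fun α : ℝ => c ^ (1 / α)) (𝓝[<] (1 : ℝ)) (𝓝 c) := by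
  have h : ContinuousAt (fun α : ℝ => c ^ (1 / α)) 1 :=
    ContinuousAt.rpow continuousAt_const (continuousAt_const.div continuousAt_id one_ne_zero)
      (Or.inl hc.ne')
  simpa using h.tendsto.mono_left nhdsWithin_le_nhds

theorem exists_globalThreshold_simeqOn (hN : 1 ≤ N) {p : ℝ} (hp : fujitaExponent N < p) :
    ∃ κ₂ : ℝ → ℕ → ℝ,
      (∀ α ∈ Ioo (0 : ℝ) 1, ∀ j : ℕ, 1 ≤ j →
        0 < κ₂ α j ∧
        (∀ κ : ℝ, 0 < κ → κ < κ₂ α j →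
          HasGlobalSolution α p (datum N κ j)) ∧
        (∀ κ : ℝ, κ₂ α j < κ →
          ¬ HasGlobalSolution α p (datum N κ j))) ∧
      SimeqOn (fun _ => {j : ℕ | 1 ≤ j})
        (fun α j => ENNReal.ofReal (κ₂ α j))
        (fun _ j => ENNReal.ofReal ((j : ℝ) ^ (2 / ((N : ℝ) * (p - 1)) - 1))) := by
  obtain ⟨hp1, -⟩ := one_lt_and_lt_sub_one_of_fujitaExponent_lt hN hp
  have hp0 : 0 < p := by linarith
  have hpm : 0 < p - 1 := by linarith
  have hC := blowupConst_pos N p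
  have hω := unitBallVolume_pos N
  obtain ⟨ε, hε, hglob⟩ := exists_hasGlobalSolution_datum hN hp
  set K := (blowupConst N p * unitBallVolume N ^ (2 / (N : ℝ))) ^ (1 / (p - 1)) with hK
  have hK0 : 0 < K := by positivity
  have hbdd : ∀ α ∈ Ioo (0 : ℝ) 1, ∀ j : ℕ, 1 ≤ j →
      ∀ κ ∈ {κ : ℝ | 0 < κ ∧ HasGlobalSolution α p (datum N κ j)},
        κ ≤ K * (j : ℝ) ^ (2 / ((N : ℝ) * (p - 1)) - 1) := fun α hα j hj κ hκ =>
    le_of_hasGlobalSolution_datum hN hα hp1 hκ.1 hj hκ.2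
  have hmem : ∀ α ∈ Ioo (0 : ℝ) 1, ∀ j : ℕ, 1 ≤ j →
      ε * (j : ℝ) ^ (2 / ((N : ℝ) * (p - 1)) - 1) ∈
        {κ : ℝ | 0 < κ ∧ HasGlobalSolution α p (datum N κ j)} := fun α hα j hj =>
    ⟨mul_pos hε (Real.rpow_pos_of_pos (by exact_mod_cast hj) _), hglob α hα j hj⟩
  have hlow : ∀ α ∈ Ioo (0 : ℝ) 1, ∀ j : ℕ, 1 ≤ j →
      ε * (j : ℝ) ^ (2 / ((N : ℝ) * (p - 1)) - 1) ≤ globalThreshold N p α j :=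
    fun α hα j hj => le_csSup ⟨_, hbdd α hα j hj⟩ (hmem α hα j hj)
  have hup : ∀ α ∈ Ioo (0 : ℝ) 1, ∀ j : ℕ, 1 ≤ j →
      globalThreshold N p α j ≤ K * (j : ℝ) ^ (2 / ((N : ℝ) * (p - 1)) - 1) :=
    fun α hα j hj => csSup_le ⟨_, hmem α hα j hj⟩ (hbdd α hα j hj)
  refine ⟨globalThreshold N p, fun α hα j hj => ?_, fun _ => ε, fun _ => K,
    fun α hα => ⟨hε, hK0, fun j hj => ?_⟩,
    limsup_ofReal_mem_Ioo hε tendsto_const_nhds, limsup_ofReal_mem_Ioo hK0 tendsto_const_nhds⟩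
  · have hpos := (hmem α hα j hj).1.trans_le (hlow α hα j hj)
    refine ⟨hpos, fun κ _ hκlt => ?_, fun κ hκlt hκ => ?_⟩
    · obtain ⟨κ', hκ', hlt⟩ := exists_lt_of_lt_csSup ⟨_, hmem α hα j hj⟩ hκlt
      have h1 : SFinite (datum N κ j) := by rw [datum_eq]; infer_instance
      have h2 : SFinite (datum N κ' j) := by rw [datum_eq]; infer_instance
      exact hκ'.2.mono hp0 (datum_mono hlt.le j)
    · exact absurd (le_csSup ⟨_, hbdd α hα j hj⟩ ⟨hpos.trans hκlt, hκ⟩) (not_le.2 hκlt)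
  · simp only
    rw [← ENNReal.ofReal_mul hε.le, ← ENNReal.ofReal_mul hK0.le]
    exact ⟨ENNReal.ofReal_le_ofReal (hlow α hα j hj), ENNReal.ofReal_le_ofReal (hup α hα j hj)⟩

theorem tendsto_lifespan_datum (hN : 1 ≤ N) {p : ℝ} (hp : fujitaExponent N < p) :
    ∀ α ∈ Ioo (0 : ℝ) 1, ∀ κ : ℝ, 0 < κ →
      Tendsto (fun j : ℕ => lifespan α p (datum N κ j)) atTop (𝓝 0) := by
  obtain ⟨hp1, -⟩ := one_lt_and_lt_sub_one_of_fujitaExponent_lt hN hp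
  have hpm : 0 < p - 1 := by linarith
  intro α hα κ hκ
  have hexp : 0 < (p - 1) / α := div_pos hpm hα.1
  have hlim : Tendsto (fun j : ℕ => ENNReal.ofReal
      (blowupConst N p ^ (1 / α) * (κ * j) ^ (-((p - 1) / α)))) atTop (𝓝 0) := by
    have h1 := ((tendsto_rpow_neg_atTop hexp).comp
      (tendsto_natCast_atTop_atTop.const_mul_atTop hκ)).const_mul (blowupConst N p ^ (1 / α))
    rw [mul_zero] at h1
    have h2 := (ENNReal.continuous_ofReal.tendsto 0).comp h1
    rw [ENNReal.ofReal_zero] at h2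
    exact h2
  refine tendsto_of_tendsto_of_tendsto_of_le_of_le' tendsto_const_nhds hlim
    (Eventually.of_forall fun _ => zero_le) ?_
  filter_upwards [eventually_lt_radius_sq hN hp hκ, eventually_ge_atTop 1] with j hj hj1
  exact lifespan_le_of_lt hN hα hp1 hκ hj1 hj

theorem exists_lifespan_simeqOn (hN : 1 ≤ N) {p : ℝ} (hp : fujitaExponent N < p) :
    ∃ j₀ : ℝ → ℝ → ℕ,
      SimeqOn
        (fun α => {x : ℝ × ℕ | 0 < x.1 ∧ 1 ≤ x.2 ∧ j₀ α x.1 ≤ x.2})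
        (fun α x => lifespan α p (datum N x.1 x.2))
        (fun α x => ENNReal.ofReal ((x.1 * (x.2 : ℝ)) ^ (-((p - 1) / α)))) := by
  obtain ⟨hp1, -⟩ := one_lt_and_lt_sub_one_of_fujitaExponent_lt hN hp
  have hp0 : 0 < p := by linarith
  have hC := blowupConst_pos N p
  have hj₀ : ∀ κ : ℝ, ∃ J : ℕ, 0 < κ → ∀ j : ℕ, J ≤ j →
      blowupConst N p * (κ * j) ^ (-(p - 1)) < radius N j ^ 2 := fun κ => by
    by_cases hκ : 0 < κ
    · obtain ⟨J, hJ⟩ := eventually_atTop.1 (eventually_lt_radius_sq hN hp hκ)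
      exact ⟨J, fun _ => hJ⟩
    · exact ⟨0, fun h => absurd h hκ⟩
  choose J hJ using hj₀
  have hc : 0 < (4 * 2 ^ p : ℝ)⁻¹ := by positivity
  -- The threshold index depends on `κ` only. The constants have the form `c^(1/α)`, with `c` free
  -- of `α`, and tend to `c > 0` as `α → 1`.
  refine ⟨fun _ κ => J κ, fun α => ((4 * 2 ^ p : ℝ)⁻¹) ^ (1 / α),
    fun α => blowupConst N p ^ (1 / α),
    fun α hα => ⟨by positivity, by positivity, fun x hx => ?_⟩,
    limsup_ofReal_mem_Ioo hc (tendsto_rpow_one_div hc),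
    limsup_ofReal_mem_Ioo hC (tendsto_rpow_one_div hC)⟩
  obtain ⟨hκ, hj, hJj⟩ := hx
  simp only
  rw [← ENNReal.ofReal_mul (by positivity), ← ENNReal.ofReal_mul (by positivity)]
  exact ⟨le_lifespan_datum hα hp0 hκ hj,
    lifespan_le_of_lt hN hα hp1 hκ hj (hJ x.1 hκ x.2 hJj)⟩

end FracFujita

theorem mainTheorem9 (N : ℕ) (hN : 1 ≤ N) (p : ℝ) (hp : FracFujita.fujitaExponent N < p) :
    (∃ κ₂ : ℝ → ℕ → ℝ,
      (∀ α ∈ Ioo (0 : ℝ) 1, ∀ j : ℕ, 1 ≤ j →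
        0 < κ₂ α j ∧
        (∀ κ : ℝ, 0 < κ → κ < κ₂ α j →
          FracFujita.HasGlobalSolution α p (FracFujita.datum N κ j)) ∧
        (∀ κ : ℝ, κ₂ α j < κ →
          ¬ FracFujita.HasGlobalSolution α p (FracFujita.datum N κ j))) ∧
      FracFujita.SimeqOn (fun _ => {j : ℕ | 1 ≤ j})
        (fun α j => ENNReal.ofReal (κ₂ α j))
        (fun _ j => ENNReal.ofReal ((j : ℝ) ^ (2 / ((N : ℝ) * (p - 1)) - 1)))) ∧
    (∀ α ∈ Ioo (0 : ℝ) 1, ∃ C : ℝ, 0 < C ∧ ∀ κ : ℝ, 0 < κ → ∀ j : ℕ, 1 ≤ j →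
      min (FracFujita.lifespan α p (FracFujita.datum N κ j) ^ (α / 2))
          (ENNReal.ofReal (FracFujita.radius N j))
        ≤ ENNReal.ofReal (C * (κ * (j : ℝ)) ^ (-((p - 1) / 2)))) ∧
    (∀ α ∈ Ioo (0 : ℝ) 1, ∀ κ : ℝ, 0 < κ →
      Tendsto (fun j : ℕ => FracFujita.lifespan α p (FracFujita.datum N κ j)) atTop (𝓝 0)) ∧
    (∃ j₀ : ℝ → ℝ → ℕ,
      FracFujita.SimeqOn
        (fun α => {x : ℝ × ℕ | 0 < x.1 ∧ 1 ≤ x.2 ∧ j₀ α x.1 ≤ x.2})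
        (fun α x => FracFujita.lifespan α p (FracFujita.datum N x.1 x.2))
        (fun α x => ENNReal.ofReal ((x.1 * (x.2 : ℝ)) ^ (-((p - 1) / α))))) := by
  exact ⟨FracFujita.exists_globalThreshold_simeqOn hN hp,
    fun _ hα => ⟨_, Real.sqrt_pos.2 (FracFujita.blowupConst_pos N p), fun _ hκ _ hj =>
      FracFujita.min_lifespan_radius_le hN hα
        (FracFujita.one_lt_and_lt_sub_one_of_fujitaExponent_lt hN hp).1 hκ hj⟩,
    FracFujita.tendsto_lifespan_datum hN hp, FracFujita.exists_lifespan_simeqOn hN hp⟩
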